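/- **Setting.** $N\ge 1$ replicas with a fixed membership, $f=\lceil N/3\rceil-1$, run the ledger-based BFT protocol L-PBFT for a deterministic service: a transaction request names a client and a stored procedure with arguments, and executing it on a key-value store yields a new store and a result; execution starts in a genesis store. The primary of view $v$ is replica $v \bmod N$, the pipeline depth is $P\ge 1$, and the checkpoint interval is $C>P$. Requests are ordered in batches with consecutive sequence numbers $s=1,2,\dots$; a batch at a multiple of $C$ is a checkpoint transaction recording the digest of the store at sequence number $s-C$. The primary signs a pre-prepare containing the view, the sequence number, the Merkle root of the ledger, the Merkle root of the batch (whose leaves are the entries $\langle t,i,o\rangle$: request $t$, ledger index $i$, result $o$), a hash of a fresh nonce, the set of replicas whose commitment evidence for $s-P$ is in the ledger, and the last checkpoint digest; backups sign prepare messages containing the hash of the pre-prepare and of a fresh nonce of their own. A replica discloses its nonce once the batch has prepared, i.e. it has the (pre-)prepares of $N-f$ replicas. The ledger contains the batches, the pre-prepares, the commitment evidence ($N-f$ signatures with nonces) for the batch at $s-P$ in the batch at $s$, and, for each view change, $N-f$ signed view-change messages (each reporting the last $P$ pre-prepares that prepared at its sender) and the signed new-view message; after a view change the last $P$ batches up to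 the last prepared one are pre-prepared again. A receipt for $\langle t,i,o\rangle$ consists of the signatures and nonces of $N-f$ replicas, the other fields of the pre-prepare, and a Merkle path; it is valid if the recreated pre-prepare has the correct signatures and nonces. Each request is signed by its client and has a minimum ledger index, below which correct replicas do not order it; a correct client sets it above all ledger indices in the valid receipts it has collected before. Ledger indices count the client transactions in ledger order, from $1$. Any number of replicas and clients may misbehave arbitrarily and the network is arbitrary; the hash function is collision-free, the signatures of correct replicas cannot be forged, and nonces of correct replicas are unknown until disclosed. **Linearizability.** Receipts $\mathcal R$ are *linearizable* if there is a sequence of authentic client requests whose serial execution from the genesis store executes, for every receipt in $\mathcal R$ for $\langle t,i,o\rangle$, the request $t$ at position $i$ with result $o$, and $i_a<i_b$ whenever $\mathcal R$ contains receipts for $\langle t_a,i_a,o_a\rangle$ and $\langle t_b,i_b,o_b\rangle$ such that the client that issued $t_b$ is correct and had received a valid receipt for $\langle t_a,i_a,o_a\rangle$ before it first issued $t_b$. Otherwise $\mathcal R$ *violates linearizability*. **Auditing.** After $\mathcal R$ has been collected, the enforcer contacts the replicas that signed a receipt $R_0\in\mathcal R$ with the highest view and, among those, the highest sequence number, and relays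 the responses received before a deadline to the auditor. A correct replica that responds returns its ledger package: its prepared ledger, together with the batches pre-prepared atomically on entering its current view, and the preparement evidence in its message box. A replica is *slow* if it was contacted and did not respond before the deadline. **Theorem (Linearizability violations).** Let $\mathcal R$ be a finite set of valid receipts that violates linearizability. Then, from $\mathcal R$ and the responses alone, the auditor assigns blame to at least $f+1$ replicas, and every blamed replica misbehaved or was slow. Here the auditor decides as follows. If at most $f$ of the contacted replicas responded, it blames the contacted replicas that did not respond. Otherwise it blames exactly the replicas that * signed a receipt in $\mathcal R$ for a transaction at an index below its minimum ledger index; or * signed $R_0$ and returned an inadmissible package. A package is admissible if its ledger is well-formed (valid up to execution results, checkpoint digests, signatures and nonces), its last view is at least that of $R_0$ and, if equal, it contains the pre-prepare of $R_0$; every message in its box is valid; the box has evidence that each of the last $P$ batches prepared; and every entry with an invalid signature or nonce is followed by a checkpoint transaction with valid commitment evidence; or, relative to an admissible package returned by a signer of $R_0$, * signed the first checkpoint transaction with valid commitment evidence after an entry with an invalid signature or nonce; or * signed two receipts in $\mathcal R$ for the same view such that the pre-prepare of the one with the higher (or equal) sequence number is in the ledger and that of the other is not; or * signed a receipt in $\mathcal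 R$ and sent, for a later view, a view-change message in the ledger that is inconsistent with having prepared the batch of the receipt: its last reported pre-prepare is missing or is earlier than that of the receipt in the order by view and then sequence number, or is of the same view and on the ledger that the new view continued, while the pre-prepare of the receipt is not; or * signed, according to valid preparement or commitment evidence in the package, the first batch at which replaying the ledger from the genesis store gives a different result or checkpoint digest. -/

import Mathlib

noncomputable section

namespace LPBFT

/-! ### System parameters, service, and data types -/

/-- A deployment with a fixed replica set: `N` replicas, pipeline depth `P ≥ 1`, checkpoint interval
`C > P`, and a deterministic service (`exec` runs the stored procedure and arguments `Cmd` of a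
client on a key-value store). -/
structure Sys where
  N : ℕ
  P : ℕ
  C : ℕ
  N_pos : 0 < N
  P_pos : 0 < P
  P_lt_C : P < C
  Client : Type
  Cmd : Type
  Out : Type
  St : Type
  Digest : Type
  Sig : Type
  Nonce : Type
  init : St
  exec : Client → Cmd → St → St × Out

/-- `f = ⌈N / 3⌉ - 1`. -/
def Sys.f (S : Sys) : ℕ := (S.N + 2) / 3 - 1

def Sys.quorum (S : Sys) : ℕ := S.N - S.f

def Sys.primary (S : Sys) (v : ℕ) : Fin S.N := ⟨v % S.N, Nat.mod_lt _ S.N_pos⟩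

/-- A transaction request, with its minimum ledger index and the client's signature. -/
structure Request (S : Sys) where
  client : S.Client
  cmd : S.Cmd
  minIdx : ℕ
  sig : S.Sig

/-- The entry `⟨t, i, o⟩`. -/
structure Tio (S : Sys) where
  req : Request S
  idx : ℕ
  out : S.Out

/-- The per-batch tree `G`; its leaves are the entries of the batch in execution order. -/
inductive Tree (S : Sys) where
  | leaf (x : Tio S)
  | node (l r : Tree S)

def Tree.leaves {S : Sys} : Tree S → List (Tio S)
  | .leaf x => [x]
  | .node l r => l.leaves ++ r.leaves

/-- The contents of a batch: client transactions, or the special checkpoint transaction that records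
a checkpoint digest. -/
inductive Body (S : Sys) where
  | txs (G : Tree S)
  | checkpoint (d : S.Digest)

def Body.tios {S : Sys} : Body S → List (Tio S)
  | .txs G => G.leaves
  | .checkpoint _ => []

/-- `⟨pre-prepare, v, s, M̄, Ḡ, H(k), E_{s-P}, d_C⟩`. There is no governance transaction besides
genesis, so the index of the last governance transaction is constant and left out. -/
structure PrePrepare (S : Sys) where
  view : ℕ
  seq : ℕ
  mroot : S.Digest
  groot : S.Digest
  hnonce : S.Digest
  ev : Finset (Fin S.N)
  dC : S.Digest

/-- A pre-prepare together with the signature of the primary. -/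
structure SignedPP (S : Sys) where
  pp : PrePrepare S
  sig : S.Sig

/-- Preparement evidence: (pre-)prepare messages of the replicas in `signers`. For the primary the
message is the pre-prepare itself, so the two functions matter only at the other signers. -/
structure PrepEv (S : Sys) where
  signers : Finset (Fin S.N)
  hnonce : Fin S.N → S.Digest
  sig : Fin S.N → S.Sig

/-- Commitment evidence: (pre-)prepare messages with the disclosed nonces. -/
structure CommitEv (S : Sys) where
  signers : Finset (Fin S.N)
  sig : Fin S.N → S.Sig
  nonce : Fin S.N → S.Nonce

/-- A signed view-change message for view `view`. -/
structure ViewChange (S : Sys) where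
  view : ℕ
  sender : Fin S.N
  pps : List (SignedPP S)
  sig : S.Sig

/-- The ledger entries of a view change: the view-change messages and the signed new-view message. -/
structure NewView (S : Sys) where
  view : ℕ
  vcs : List (ViewChange S)
  sig : S.Sig

/-- The ledger entries of a batch at `s`: commitment evidence for `s - P`, the pre-prepare, and the
entries of the batch. -/
structure Batch (S : Sys) where
  ev : Option (CommitEv S)
  spp : SignedPP S
  body : Body S

def Batch.seq {S : Sys} (b : Batch S) : ℕ := b.spp.pp.seq

inductive Block (S : Sys) where
  | batch (b : Batch S)
  | newView (n : NewView S)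

/-- A ledger, starting right after the genesis transaction (sequence number and index `0`). -/
abbrev Ledger (S : Sys) := List (Block S)

/-- The messages that replicas sign. -/
inductive Msg (S : Sys) where
  | prePrepare (pp : PrePrepare S)
  | prepare (r : Fin S.N) (hnonce hpp : S.Digest)
  | viewChange (view : ℕ) (r : Fin S.N) (pps : List (SignedPP S))
  | newView (view : ℕ) (mroot : S.Digest) (senders : Finset (Fin S.N)) (hvc : S.Digest)

/-- Everything that is ever hashed. -/
inductive Preimage (S : Sys) where
  | genesis
  | leaf (x : Tio S)
  | node (l r : S.Digest)
  | checkpoint (d : S.Digest)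
  | nonce (k : S.Nonce)
  | signedPP (p : SignedPP S)
  | entry (d : S.Digest) (b : Block S)
  | withEvidence (d : S.Digest) (c : Option (CommitEv S))
  | viewChanges (vcs : List (ViewChange S))
  | withViewChanges (d : S.Digest) (vcs : List (ViewChange S))
  | state (σ : S.St)

/-- Idealized cryptography: a collision-free hash function, and the relations "this signature of this
replica (client) on this message (request) verifies". -/
structure Crypto (S : Sys) where
  hash : Preimage S → S.Digest
  hash_injective : Function.Injective hash
  verify : Fin S.N → Msg S → S.Sig → Prop
  verifyReq : S.Client → S.Cmd → ℕ → S.Sig → Prop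

def Request.Authentic {S : Sys} (K : Crypto S) (t : Request S) : Prop :=
  K.verifyReq t.client t.cmd t.minIdx t.sig

/-! ### Digests and evidence -/

section
variable {S : Sys} (K : Crypto S)

/-- The root of the per-batch Merkle tree. -/
def Tree.root : Tree S → S.Digest
  | .leaf x => K.hash (.leaf x)
  | .node l r => K.hash (.node (Tree.root l) (Tree.root r))

def Body.root : Body S → S.Digest
  | .txs G => G.root K
  | .checkpoint d => K.hash (.checkpoint d)

/-- The root of the tree `M` that binds all entries of the ledger, in order. -/
def root (L : Ledger S) : S.Digest :=
  L.foldl (fun d b => K.hash (.entry d b)) (K.hash .genesis)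

/-- At least `N - f` replicas pre-prepared/prepared the batch with this signed pre-prepare. -/
def PrepEv.Valid (p : SignedPP S) (e : PrepEv S) : Prop :=
  S.quorum ≤ e.signers.card ∧
  K.verify (S.primary p.pp.view) (.prePrepare p.pp) p.sig ∧
  ∀ r ∈ e.signers, r ≠ S.primary p.pp.view →
    K.verify r (.prepare r (e.hnonce r) (K.hash (.signedPP p))) (e.sig r)

def CommitEv.toPrep (c : CommitEv S) : PrepEv S :=
  ⟨c.signers, fun r => K.hash (.nonce (c.nonce r)), c.sig⟩

/-- Moreover each of them disclosed the nonce that it committed to. -/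
def CommitEv.Valid (p : SignedPP S) (c : CommitEv S) : Prop :=
  (c.toPrep K).Valid K p ∧
  (S.primary p.pp.view ∈ c.signers →
    K.hash (.nonce (c.nonce (S.primary p.pp.view))) = p.pp.hnonce)

end

/-! ### Receipts -/

/-- A receipt `⟨⟨t, i, o⟩, x⟩`. In `path`, `true` marks a sibling on the left. -/
structure Receipt (S : Sys) where
  tio : Tio S
  view : ℕ
  seq : ℕ
  mroot : S.Digest
  hnonce : S.Digest
  ev : Finset (Fin S.N)
  dC : S.Digest
  sigP : S.Sig
  cert : CommitEv S
  path : List (Bool × S.Digest)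

namespace Receipt
variable {S : Sys} (K : Crypto S)

def groot (R : Receipt S) : S.Digest :=
  R.path.foldl (fun d g => if g.1 then K.hash (.node g.2 d) else K.hash (.node d g.2))
    (K.hash (.leaf R.tio))

/-- The pre-prepare that is recreated from the receipt. -/
def pp (R : Receipt S) : PrePrepare S :=
  ⟨R.view, R.seq, R.mroot, R.groot K, R.hnonce, R.ev, R.dC⟩

/-- Receipt verification. -/
def Valid (R : Receipt S) : Prop := R.cert.Valid K ⟨R.pp K, R.sigP⟩

/-- The replicas that signed the receipt. -/
def signers (R : Receipt S) : Finset (Fin S.N) := R.cert.signers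

end Receipt

/-! ### Ledgers -/

section
variable {S : Sys}

def batches (L : Ledger S) : List (Batch S) :=
  L.filterMap fun b => match b with
    | .batch b => some b
    | .newView _ => none

/-- The sequence number of the last batch. -/
def len (L : Ledger S) : ℕ := (batches L).length

def signedPPs (L : Ledger S) : List (SignedPP S) := (batches L).map Batch.spp

def pps (L : Ledger S) : List (PrePrepare S) := (signedPPs L).map SignedPP.pp

def bodies (L : Ledger S) : List (Body S) := (batches L).map Batch.body

def tios (L : Ledger S) : List (Tio S) := (bodies L).flatMap Body.tios

/-- The view of the last new-view entry, and `0` if there is none. -/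
def curView (L : Ledger S) : ℕ :=
  L.foldl (fun v b => match b with
    | .batch _ => v
    | .newView n => n.view) 0

/-- The pre-prepares of the last `P` batches. -/
def lastPPs (L : Ledger S) : List (SignedPP S) := (signedPPs L).drop (len L - S.P)

variable (K : Crypto S)

/-- The digest in the last checkpoint transaction, and that of the genesis state if there is none. -/
def lastCheckpoint (L : Ledger S) : S.Digest :=
  (bodies L).foldl (fun d b => match b with
    | .txs _ => d
    | .checkpoint d' => d') (K.hash (.state S.init))

/-- `b` has the form of the next batch after the ledger `L`: it continues `L` in the current view, the
evidence for `s - P` is present, checkpoint transactions are exactly at the multiples of `C`, client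
transactions have consecutive indices and respect their minimum index. Nothing is said about
execution results, the values of checkpoint digests, signatures and nonces. -/
def BatchOK (L : Ledger S) (b : Batch S) : Prop :=
  b.spp.pp.view = curView L ∧
  b.seq = len L + 1 ∧
  b.spp.pp.mroot = K.hash (.withEvidence (root K L) b.ev) ∧
  b.spp.pp.groot = b.body.root K ∧
  b.spp.pp.dC = lastCheckpoint K L ∧
  (b.seq ≤ S.P → b.ev = none ∧ b.spp.pp.ev = ∅) ∧
  (S.P < b.seq → ∃ c, b.ev = some c ∧ S.quorum ≤ c.signers.card ∧ b.spp.pp.ev = c.signers) ∧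
  match b.body with
  | .checkpoint _ => S.C ∣ b.seq
  | .txs G => ¬ S.C ∣ b.seq ∧ ∀ k x, G.leaves[k]? = some x →
      x.idx = (tios L).length + 1 + k ∧ x.req.minIdx ≤ x.idx

/-- `p` prepared no later than `q`: smaller view, or same view and at most the same sequence number. -/
def LexLE (p q : PrePrepare S) : Prop :=
  p.view < q.view ∨ (p.view = q.view ∧ p.seq ≤ q.seq)

/-- The outcome of processing the view-change messages of `n`. There are at least `N - f` of them,
from different replicas. The last prepared pre-prepare among those of the largest view is the one at
the end of the ledger `L ++ old`, where `old` are its last `P` batches (all batches, if there are fewer);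
these are the ones that have to be proposed again, after the ledger has been truncated to `L`, just
before the first entry of the first of them. All reports of pre-prepares of that same view lie in
`L ++ old`: otherwise two different batches would have prepared in one view, which is impossible with at
most `f` misbehaving replicas. If nothing prepared, the ledger is empty. -/
def Selects (L : Ledger S) (n : NewView S) (old : List (Batch S)) : Prop :=
  curView L < n.view ∧
  (n.vcs.map ViewChange.sender).Nodup ∧
  S.quorum ≤ n.vcs.length ∧
  (∀ vc ∈ n.vcs, vc.view = n.view) ∧
  ((L = [] ∧ old = [] ∧ ∀ vc ∈ n.vcs, vc.pps = []) ∨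
    ∃ top, old.getLast? = some top ∧
      old.length = min S.P (len L + old.length) ∧
      (∃ vc ∈ n.vcs, vc.pps = old.map Batch.spp) ∧
      ∀ vc ∈ n.vcs, ∀ q, vc.pps.getLast? = some q →
        LexLE q.pp top.spp.pp ∧
        (q.pp.view = curView L → q.pp ∈ pps (L ++ old.map .batch)))

/-- In the new view the same batches are pre-prepared again, with the same contents and evidence. -/
def Reproposes (L : Ledger S) (n : NewView S) (old new : List (Batch S)) : Prop :=
  List.Forall₂ (fun o b => b.ev = o.ev ∧ b.body = o.body) old new ∧
  ∀ b₁ b b₂, new = b₁ ++ b :: b₂ → BatchOK K (L ++ .newView n :: b₁.map .batch) b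

/-- Well-formed ledgers: they would be valid if not for incorrect execution results, incorrect
checkpoint digests, and invalid signatures or nonces. The batches that are proposed again in a new view
are added atomically. -/
inductive WellFormed : Ledger S → Prop
  | nil : WellFormed []
  | batch (L : Ledger S) (b : Batch S) :
      WellFormed L → BatchOK K L b → WellFormed (L ++ [.batch b])
  | newView (L : Ledger S) (n : NewView S) (old new : List (Batch S)) :
      WellFormed (L ++ old.map .batch) → Selects L n old → Reproposes K L n old new →
      WellFormed (L ++ .newView n :: new.map .batch)

/-- All signatures and nonces in the entries `b` are valid, where `L` is the ledger before `b`. -/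
def SignaturesOK (L : Ledger S) : Block S → Prop
  | .batch b =>
      K.verify (S.primary b.spp.pp.view) (.prePrepare b.spp.pp) b.spp.sig ∧
      (∀ x ∈ b.body.tios, x.req.Authentic K) ∧
      ∀ c, b.ev = some c → ∀ b' ∈ batches L, b'.seq + S.P = b.seq → c.Valid K b'.spp
  | .newView n =>
      (∀ vc ∈ n.vcs, K.verify vc.sender (.viewChange vc.view vc.sender vc.pps) vc.sig ∧
        ∀ q ∈ vc.pps, K.verify (S.primary q.pp.view) (.prePrepare q.pp) q.sig) ∧
      K.verify (S.primary n.view)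
        (.newView n.view (K.hash (.withViewChanges (root K L) n.vcs))
          (Finset.univ.filter fun r => ∃ vc ∈ n.vcs, vc.sender = r)
          (K.hash (.viewChanges n.vcs))) n.sig

/-- The ledger contains, at `s + P`, valid commitment evidence `c` for the batch at `s`. -/
def CommittedBy (L : Ledger S) (s : ℕ) (c : CommitEv S) : Prop :=
  ∃ b ∈ batches L, ∃ b' ∈ batches L, b.seq = s ∧ b'.seq = s + S.P ∧ b'.ev = some c ∧
    c.Valid K b.spp

/-! ### Replay -/

def Tio.run (σ : S.St) (x : Tio S) : S.St := (S.exec x.req.client x.req.cmd σ).1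

def Body.run (σ : S.St) (b : Body S) : S.St := b.tios.foldl Tio.run σ

/-- The `n`-th batch reports what its execution produces, if the batches after the `base`-th are
executed from the state `σ`: the results of its transactions, or the digest of the checkpoint
at `n - C`. -/
def CorrectAt (base : ℕ) (σ : S.St) (bs : List (Body S)) (n : ℕ) : Prop :=
  let st : ℕ → S.St := fun m => ((bs.take m).drop base).foldl Body.run σ
  ∀ b, bs[n - 1]? = some b →
    match b with
    | .txs G => ∀ xs x ys, G.leaves = xs ++ x :: ys →
        (S.exec x.req.client x.req.cmd (xs.foldl Tio.run (st (n - 1)))).2 = x.out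
    | .checkpoint d => d = K.hash (.state (st (n - S.C)))

/-- What a correct replica has checked about its ledger. Either (`base = 0`) it has executed everything
from the genesis state and verified all signatures, or it has loaded the checkpoint `σ` taken at
`base`, the ledger extends at least to `base + C + P` (so that it contains the checkpoint transaction at
`base + C`, which records the digest of `σ`, and the evidence for that transaction), the replica has
executed everything after `base`, and it has verified the signatures and nonces from the checkpoint
transaction at `base + C` on. -/
def Verified (base : ℕ) (σ : S.St) (L : Ledger S) : Prop :=
  ((base = 0 ∧ σ = S.init) ∨ (0 < base ∧ S.C ∣ base ∧ base + S.C + S.P ≤ len L)) ∧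
  (∀ n, base < n → n ≤ len L → CorrectAt K base σ (bodies L) n) ∧
  ∀ A b B, L = A ++ b :: B → (0 < base → base + S.C ≤ len (A ++ [b])) → SignaturesOK K A b

end

/-! ### Correct replicas -/

/-- A ledger package: the ledger `F + U` (starting at genesis, whose checkpoint is the initial state)
and messages from the message box, here in the form of preparement evidence. -/
structure Package (S : Sys) where
  ledger : Ledger S
  box : List (SignedPP S × PrepEv S)

/-- The local state of a replica. `prep` is the ledger up to the last locally prepared batch, `stable`
is `F + U`: the prepared batches, or, as long as nothing prepared in the current view, the ledger up to
the batches that were pre-prepared atomically when the view was entered. `base`, `baseSt` is the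
checkpoint that the replica started from. `signed` and `revealed` are the (view, sequence number) pairs
for which it has signed a (pre-)prepare, and for which it has disclosed its nonce. -/
structure RState (S : Sys) where
  view : ℕ
  ready : Prop
  ledger : Ledger S
  prep : Ledger S
  stable : Ledger S
  base : ℕ
  baseSt : S.St
  box : List (SignedPP S × PrepEv S)
  sent : List (Msg S)
  signed : Set (ℕ × ℕ)
  revealed : Set (ℕ × ℕ)

def RState.start (S : Sys) : RState S :=
  ⟨0, True, [], [], [], 0, S.init, [], [], ∅, ∅⟩

def RState.package {S : Sys} (s : RState S) : Package S := ⟨s.stable, s.box⟩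

section
variable {S : Sys} (K : Crypto S)

/-- The message that replica `r` signs when it pre-prepares the batch `b`. -/
def orderMsg (r : Fin S.N) (nonce : ℕ → ℕ → S.Nonce) (b : Batch S) : Msg S :=
  open Classical in
  if r = S.primary b.spp.pp.view then .prePrepare b.spp.pp
  else .prepare r (K.hash (.nonce (nonce b.spp.pp.view b.seq))) (K.hash (.signedPP b.spp))

/-- If `r` is the primary, it commits to its own nonce in the pre-prepare. -/
def OwnNonce (r : Fin S.N) (nonce : ℕ → ℕ → S.Nonce) (b : Batch S) : Prop :=
  r = S.primary b.spp.pp.view → b.spp.pp.hnonce = K.hash (.nonce (nonce b.spp.pp.view b.seq))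

/-- The message box `box` proves that each of the last `P` batches of `L` prepared. -/
def HasPrepares (box : List (SignedPP S × PrepEv S)) (L : Ledger S) : Prop :=
  ∀ b ∈ batches L, len L < b.seq + S.P → ∃ e, (b.spp, e) ∈ box

/-- The steps of a correct replica `r`, whose nonce for view `v` and sequence number `s` is
`nonce v s`. The network is arbitrary: whatever the replica uses from other parties is only constrained
by the checks that the replica makes. -/
inductive Step (r : Fin S.N) (nonce : ℕ → ℕ → S.Nonce) : RState S → RState S → Prop
  /-- Receive prepare messages for some pre-prepare. -/
  | receive (s : RState S) (p : SignedPP S) (e : PrepEv S) :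
      e.Valid K p → Step r nonce s { s with box := (p, e) :: s.box }
  /-- Pre-prepare the next batch (as primary or as backup), after executing it. -/
  | order (s : RState S) (b : Batch S) :
      s.ready → b.spp.pp.view = s.view → (s.view, b.seq) ∉ s.signed →
      BatchOK K s.ledger b → OwnNonce K r nonce b →
      Verified K s.base s.baseSt (s.ledger ++ [.batch b]) →
      Step r nonce s { s with
        ledger := s.ledger ++ [.batch b]
        sent := s.sent ++ [orderMsg K r nonce b]
        signed := insert (s.view, b.seq) s.signed }
  /-- Batches up to the end of `L` prepare in the current view; the nonces for them are disclosed.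
  Batches that were proposed again when the view was entered prepare together, as `L` has to be
  well-formed. -/
  | prepare (s : RState S) (L : Ledger S) :
      s.ready → L <+: s.ledger → WellFormed K L → curView L = s.view →
      (∃ p ∈ pps L, p.view = s.view) →
      (curView s.prep = s.view → s.prep.length < L.length) →
      HasPrepares s.box L →
      Step r nonce s { s with
        prep := L
        stable := L
        revealed := s.revealed ∪ {x | x ∈ s.signed ∧ x.1 = s.view ∧ x.2 ≤ len L} }
  /-- Leave the current view for a later one; report the last `P` prepared pre-prepares. -/
  | viewChange (s : RState S) (w : ℕ) :
      s.view < w →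
      Step r nonce s { s with
        view := w
        ready := False
        sent := s.sent ++ [.viewChange w r (lastPPs s.prep)] }
  /-- Enter the current view with a new-view message (as primary or as backup). -/
  | newView (s : RState S) (L : Ledger S) (n : NewView S) (old new : List (Batch S)) :
      ¬ s.ready → n.view = s.view →
      WellFormed K (L ++ old.map .batch) → Selects L n old → Reproposes K L n old new →
      (∀ o ∈ old, ∃ e, (o.spp, e) ∈ s.box) →
      (∀ vc ∈ n.vcs, ∀ q, vc.pps.getLast? = some q → ∃ e, (q, e) ∈ s.box) →
      (∀ b ∈ new, (s.view, b.seq) ∉ s.signed ∧ OwnNonce K r nonce b) →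
      Verified K s.base s.baseSt (L ++ .newView n :: new.map .batch) →
      Step r nonce s { s with
        ready := True
        ledger := L ++ .newView n :: new.map .batch
        stable := L ++ .newView n :: new.map .batch
        sent := s.sent ++
          (open Classical in if r = S.primary n.view then
            [.newView n.view (K.hash (.withViewChanges (root K L) n.vcs))
              (Finset.univ.filter fun r => ∃ vc ∈ n.vcs, vc.sender = r)
              (K.hash (.viewChanges n.vcs))]
          else []) ++ new.map (orderMsg K r nonce)
        signed := s.signed ∪ {x | x.1 = s.view ∧ ∃ b ∈ new, x.2 = b.seq} }
  /-- Catch up by fetching a well-formed ledger of prepared batches, possibly with a checkpoint `σ`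
  taken at `base`, in which case the part before is neither executed nor are all its signatures
  verified. -/
  | fetch (s : RState S) (L : Ledger S) (base : ℕ) (σ : S.St) :
      WellFormed K L → s.view ≤ curView L →
      (s.ready → curView L = s.view → s.ledger <+: L) →
      (∃ p ∈ pps L, p.view = curView L) →
      HasPrepares s.box L →
      Verified K base σ L → (0 < base → ∃ c, CommittedBy K L base c) →
      Step r nonce s { s with
        view := curView L
        ready := True
        ledger := L
        prep := L
        stable := L
        base := base
        baseSt := σ }

end

/-! ### Executions -/

inductive ClientEvent (S : Sys) where
  | receive (R : Receipt S)
  | issue (t : Request S)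

/-- An execution with arbitrarily many misbehaving replicas and clients, about which nothing is assumed.
Each correct replica takes protocol steps only, first up to the state `atAudit r` in which it is contacted
by the enforcer (if it is), then up to `final r`. Its nonces are fresh, and its signatures cannot be
forged. A correct client sets the minimum index of each request that it issues above all ledger indices
it knows from the receipts that it has collected before. -/
structure Execution {S : Sys} (K : Crypto S) where
  correct : Set (Fin S.N)
  nonce : Fin S.N → ℕ → ℕ → S.Nonce
  atAudit : Fin S.N → RState S
  final : Fin S.N → RState S
  nonce_fresh : ∀ r ∈ correct, ∀ v s v' s', nonce r v s = nonce r v' s' → v = v' ∧ s = s'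
  run_atAudit : ∀ r ∈ correct,
    Relation.ReflTransGen (Step K r (nonce r)) (RState.start S) (atAudit r)
  run_final : ∀ r ∈ correct,
    Relation.ReflTransGen (Step K r (nonce r)) (atAudit r) (final r)
  unforgeable : ∀ r ∈ correct, ∀ m σ, K.verify r m σ → m ∈ (final r).sent
  correctClient : Set S.Client
  history : S.Client → List (ClientEvent S)
  minIdx_rule : ∀ c ∈ correctClient, ∀ h t h', history c = h ++ .issue t :: h' → .issue t ∉ h →
    ∀ R, .receive R ∈ h → R.Valid K → R.tio.idx + 1 ≤ t.minIdx

section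
variable {S : Sys} {K : Crypto S} (E : Execution K)

/-- The receipts have been collected before the replicas are contacted: the nonce of a correct replica
can occur in them only if the replica has disclosed it by then. -/
def Execution.Collected (Rs : Finset (Receipt S)) : Prop :=
  ∀ R ∈ Rs, ∀ r ∈ R.signers, r ∈ E.correct → ∀ v s, R.cert.nonce r = E.nonce r v s →
    (v, s) ∈ (E.atAudit r).revealed

/-- Real-time order: the correct client that issued `y` had received a valid receipt for `x` before. -/
def Execution.Before (x y : Tio S) : Prop :=
  y.req.client ∈ E.correctClient ∧
  ∃ h h', E.history y.req.client = h ++ .issue y.req :: h' ∧ .issue y.req ∉ h ∧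
    ∃ R, .receive R ∈ h ∧ R.Valid K ∧ R.tio = x

/-- In the serial execution of `ts` from the genesis state, `x.req` is executed at index `x.idx` (counted
from `1`) with result `x.out`. -/
def Produces (ts : List (Request S)) (x : Tio S) : Prop :=
  1 ≤ x.idx ∧ ts[x.idx - 1]? = some x.req ∧
  (S.exec x.req.client x.req.cmd
    ((ts.take (x.idx - 1)).foldl (fun σ t => (S.exec t.client t.cmd σ).1) S.init)).2 = x.out

/-- The serial execution of the authentic client requests `ts` produces all the receipts. -/
def SerializedBy (K : Crypto S) (Rs : Finset (Receipt S)) (ts : List (Request S)) : Prop :=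
  (∀ t ∈ ts, t.Authentic K) ∧ ∀ R ∈ Rs, Produces ts R.tio

/-- Some serial execution produces all the receipts in an order that respects the real-time order. -/
def Execution.Linearizable (Rs : Finset (Receipt S)) : Prop :=
  ∃ ts, SerializedBy K Rs ts ∧
    ∀ a ∈ Rs, ∀ b ∈ Rs, E.Before a.tio b.tio → a.tio.idx < b.tio.idx

end

/-! ### Enforcement and auditing -/

section
variable {S : Sys} (K : Crypto S)

/-- A receipt with the highest view and, among these, the highest sequence number. -/
def IsLatest (Rs : Finset (Receipt S)) (R₀ : Receipt S) : Prop :=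
  R₀ ∈ Rs ∧ ∀ R ∈ Rs, R.view < R₀.view ∨ (R.view = R₀.view ∧ R.seq ≤ R₀.seq)

/-- In the ledger `L = A ++ newView n :: _`, the ledger `A ++ old` is the one that the new view continued.
It is reconstructed from the view-change messages and from the batches that are proposed again. -/
def Lineage (L A : Ledger S) (n : NewView S) (old : List (Batch S)) : Prop :=
  (∃ B, L = A ++ .newView n :: B) ∧
  WellFormed K (A ++ old.map .batch) ∧ Selects A n old ∧
  ∀ o ∈ old, ∃ b ∈ batches L, b.seq = o.seq ∧ b.ev = o.ev ∧ b.body = o.body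

/-- `p` is the pre-prepare of the batch at `n` in `L`, or that of the same batch in the earlier view from
which it was taken over. -/
def Concerns (L : Ledger S) (n : ℕ) (p : SignedPP S) : Prop :=
  p.pp.seq = n ∧ (p ∈ signedPPs L ∨ ∃ A nv old, Lineage K L A nv old ∧ ∃ o ∈ old, o.spp = p)

/-- What the auditor demands of the ledger package of a replica that signed the receipt `R₀`: the ledger
is well-formed and reaches the view of `R₀`; unless it reaches a later view it contains the pre-prepare of
`R₀`; there is valid preparement evidence also for the last `P` batches, and no invalid message in the
message box; and whenever a signature or nonce in the ledger is invalid, a later checkpoint transaction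
has valid evidence. -/
def Admissible (R₀ : Receipt S) (p : Package S) : Prop :=
  WellFormed K p.ledger ∧
  R₀.view ≤ curView p.ledger ∧
  (curView p.ledger = R₀.view → R₀.pp K ∈ pps p.ledger) ∧
  (∀ e ∈ p.box, e.2.Valid K e.1) ∧
  (∀ n, 1 ≤ n → n ≤ len p.ledger → len p.ledger < n + S.P →
    ∃ e ∈ p.box, Concerns K p.ledger n e.1) ∧
  ∀ A b B, p.ledger = A ++ b :: B → ¬ SignaturesOK K A b →
    ∃ s c, S.C ∣ s ∧ len (A ++ [b]) < s ∧ CommittedBy K p.ledger s c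

/-- The view-change message is consistent with its sender having prepared `q` in an earlier view, where
`L` is the ledger that the new view continued: the last reported pre-prepare is not earlier than `q`, and
if it is of the same view and belongs to `L`, then so does `q`. -/
def Reports (L : Ledger S) (vc : ViewChange S) (q : PrePrepare S) : Prop :=
  ∃ p, vc.pps.getLast? = some p ∧ LexLE q p.pp ∧
    (p.pp.view = q.view → p.pp ∈ pps L → q ∈ pps L)

/-- The grounds on which the auditor blames a replica `r`, given receipts `Rs`, a latest receipt `R₀`, and
the relayed responses `resp` of replicas that signed `R₀`. -/
inductive Blamed (Rs : Finset (Receipt S)) (R₀ : Receipt S) (resp : Fin S.N → Option (Package S)) :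
    Fin S.N → Prop
  /-- `r` signed a receipt for a transaction below its minimum ledger index. -/
  | minIndex (r : Fin S.N) (R : Receipt S) :
      R ∈ Rs → r ∈ R.signers → R.tio.idx < R.tio.req.minIdx → Blamed Rs R₀ resp r
  /-- `r` returned an inadmissible ledger package. -/
  | badPackage (r : Fin S.N) (p : Package S) :
      r ∈ R₀.signers → resp r = some p → ¬ Admissible K R₀ p → Blamed Rs R₀ resp r
  /-- The ledger contains an invalid signature or nonce, and `r` signed the first subsequent checkpoint
  transaction that has valid evidence. -/
  | badSignature (r r' : Fin S.N) (p : Package S) (A B : Ledger S) (b : Block S) (s : ℕ)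
      (c : CommitEv S) :
      r' ∈ R₀.signers → resp r' = some p → Admissible K R₀ p →
      p.ledger = A ++ b :: B → ¬ SignaturesOK K A b →
      S.C ∣ s → len (A ++ [b]) < s → CommittedBy K p.ledger s c →
      (∀ s' c', S.C ∣ s' → len (A ++ [b]) < s' → s' < s → ¬ CommittedBy K p.ledger s' c') →
      r ∈ c.signers → Blamed Rs R₀ resp r
  /-- `r` signed two receipts in the same view, of which the later one belongs to the ledger and the
  earlier one does not. -/
  | sameView (r r' : Fin S.N) (p : Package S) (R R' : Receipt S) :
      r' ∈ R₀.signers → resp r' = some p → Admissible K R₀ p →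
      R ∈ Rs → R' ∈ Rs → R.view = R'.view → R.seq ≤ R'.seq →
      R'.pp K ∈ pps p.ledger → R.pp K ∉ pps p.ledger →
      r ∈ R.signers → r ∈ R'.signers → Blamed Rs R₀ resp r
  /-- `r` signed a receipt and did not properly report its batch in a later view change. -/
  | viewChange (r r' : Fin S.N) (p : Package S) (R : Receipt S) (A : Ledger S) (n : NewView S)
      (old : List (Batch S)) (vc : ViewChange S) :
      r' ∈ R₀.signers → resp r' = some p → Admissible K R₀ p →
      R ∈ Rs → r ∈ R.signers →
      Lineage K p.ledger A n old → R.view < n.view →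
      vc ∈ n.vcs → vc.sender = r →
      K.verify r (.viewChange vc.view vc.sender vc.pps) vc.sig →
      ¬ Reports (A ++ old.map .batch) vc (R.pp K) → Blamed Rs R₀ resp r
  /-- Replaying the ledger from genesis first fails at `n`, and `r` signed that batch. -/
  | replay (r r' : Fin S.N) (p : Package S) (n : ℕ) (q : SignedPP S) (e : PrepEv S) :
      r' ∈ R₀.signers → resp r' = some p → Admissible K R₀ p →
      1 ≤ n → n ≤ len p.ledger → ¬ CorrectAt K 0 S.init (bodies p.ledger) n →
      (∀ m, 1 ≤ m → m < n → CorrectAt K 0 S.init (bodies p.ledger) m) →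
      Concerns K p.ledger n q → e.Valid K q →
      ((q, e) ∈ p.box ∨ ∃ c, CommittedBy K p.ledger n c ∧ c.toPrep K = e) →
      r ∈ e.signers → Blamed Rs R₀ resp r

/-- The replicas that signed `R₀` and responded to the enforcer before the deadline. -/
def responders (R₀ : Receipt S) (resp : Fin S.N → Option (Package S)) : Finset (Fin S.N) :=
  R₀.signers.filter fun r => (resp r).isSome

/-- The replicas that are blamed: if at least `f + 1` of the contacted replicas respond before the
deadline, those against which the auditor finds grounds in the receipts and responses; otherwise the
unresponsive ones. -/
def blame (Rs : Finset (Receipt S)) (R₀ : Receipt S) (resp : Fin S.N → Option (Package S)) :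
    Finset (Fin S.N) :=
  open Classical in
  if S.f + 1 ≤ (responders R₀ resp).card then Finset.univ.filter (Blamed K Rs R₀ resp)
  else R₀.signers \ responders R₀ resp

end

end LPBFT

end

open LPBFT

namespace LPBFT

/-! ### Elementary facts on ledgers -/

section
variable {S : Sys} {K : Crypto S}

/-! The proof has two independent halves; neither bounds the number of misbehaving replicas.

No correct replica is blamed (`not_blamed`). Along each run of a correct replica the invariant `Inv`
is maintained, with a ghost set of the batches signed so far, each paired with the ledger it
continued. Unforgeability turns valid evidence into a member of this set (`Inv.exists_of_prepEv`),
and the nonce in a collected receipt shows that the batch had prepared locally before the audit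
(`Execution.revealed_of_receipt`). Since hashing is injective, a pre-prepare pins the whole ledger
before it (`BatchOK.determined`), so what the replica checked on its own ledger holds for the
audited one. Batches signed in one view lie on one chain, and prepared batches are reflected in
later reports (`Covers.reports`). The delicate grounds concern a replica that started from a
checkpoint without checking what precedes it: its execution agrees with the replay from genesis if
that replay succeeds up to the batch it signed (`Checked.correctAt`), and a checkpoint transaction
that it signs after an invalid signature is never the first committed one (`Checked.committedBy`).

Enough replicas are blamed (`le_card_blamed`). If at most `f` were, every set of `f + 1` replicas
would have an unblamed member. Among the responders it supplies an admissible package; in one quorum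
it forces valid signatures and a correct replay; in the intersection of two quorums it forces every
receipt into the ledger, up to batches proposed again with the same body in later views. The
requests of the ledger then serialize all receipts, and minimum indices give the real-time order,
against the assumed violation. If at most `f` signers respond, a quorum leaves at least `f + 1`
unresponsive ones. -/

@[simp] theorem batches_nil : batches ([] : Ledger S) = [] := rfl

@[simp] theorem batches_append (A B : Ledger S) : batches (A ++ B) = batches A ++ batches B := by
  simp [batches]

@[simp] theorem batches_cons_batch (b : Batch S) (A : Ledger S) :
    batches (.batch b :: A) = b :: batches A := rfl

@[simp] theorem batches_cons_newView (n : NewView S) (A : Ledger S) :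
    batches (.newView n :: A) = batches A := rfl

@[simp] theorem batches_map_batch (bs : List (Batch S)) : batches (bs.map Block.batch) = bs := by
  induction bs with
  | nil => rfl
  | cons b bs ih => simp [ih]

@[simp] theorem len_nil : len ([] : Ledger S) = 0 := rfl

@[simp] theorem len_append (A B : Ledger S) : len (A ++ B) = len A + len B := by simp [len]

@[simp] theorem len_cons_batch (b : Batch S) (A : Ledger S) : len (.batch b :: A) = len A + 1 := rfl

@[simp] theorem len_cons_newView (n : NewView S) (A : Ledger S) : len (.newView n :: A) = len A := rfl

@[simp] theorem len_map_batch (bs : List (Batch S)) : len (bs.map Block.batch) = bs.length := by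
  simp [len]

theorem len_le_of_prefix {A B : Ledger S} (h : A <+: B) : len A ≤ len B := by
  obtain ⟨C, rfl⟩ := h
  simp

theorem mem_batches_of_prefix {A B : Ledger S} (h : A <+: B) {b : Batch S} (hb : b ∈ batches A) :
    b ∈ batches B := by
  obtain ⟨C, rfl⟩ := h
  simp [hb]

theorem mem_pps {L : Ledger S} {p : PrePrepare S} :
    p ∈ pps L ↔ ∃ b ∈ batches L, b.spp.pp = p := by
  simp [pps, signedPPs]

theorem mem_signedPPs {L : Ledger S} {p : SignedPP S} :
    p ∈ signedPPs L ↔ ∃ b ∈ batches L, b.spp = p := by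
  simp [signedPPs]

theorem mem_pps_of_prefix {A B : Ledger S} (h : A <+: B) {p : PrePrepare S} (hp : p ∈ pps A) :
    p ∈ pps B := by
  rw [mem_pps] at *
  obtain ⟨b, hb, rfl⟩ := hp
  exact ⟨b, mem_batches_of_prefix h hb, rfl⟩

@[simp] theorem bodies_append (A B : Ledger S) : bodies (A ++ B) = bodies A ++ bodies B := by
  simp [bodies]

@[simp] theorem length_bodies (L : Ledger S) : (bodies L).length = len L := by simp [bodies, len]

theorem bodies_prefix {A B : Ledger S} (h : A <+: B) : bodies A <+: bodies B := by
  obtain ⟨C, rfl⟩ := h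
  simp

@[simp] theorem tios_append (A B : Ledger S) : tios (A ++ B) = tios A ++ tios B := by
  simp [tios]

theorem mem_batches {L : Ledger S} {b : Batch S} :
    b ∈ batches L ↔ ∃ A B, L = A ++ .batch b :: B := by
  constructor
  · intro h
    obtain ⟨x, hx, hxb⟩ := List.mem_filterMap.1 h
    cases x with
    | batch b' =>
      simp only [Option.some.injEq] at hxb
      subst hxb
      exact List.append_of_mem hx
    | newView n => simp at hxb
  · rintro ⟨A, B, rfl⟩
    simp

theorem exists_split_of_getElem? {L : Ledger S} {k : ℕ} {b : Batch S}
    (h : (batches L)[k]? = some b) : ∃ A B, L = A ++ .batch b :: B ∧ len A = k := by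
  induction L generalizing k with
  | nil => simp at h
  | cons x L ih =>
    cases x with
    | newView n =>
      obtain ⟨A, B, rfl, hA⟩ := ih (by simpa using h)
      exact ⟨.newView n :: A, B, rfl, by simpa using hA⟩
    | batch b' =>
      cases k with
      | zero =>
        simp only [batches_cons_batch, List.getElem?_cons_zero, Option.some.injEq] at h
        subst h
        exact ⟨[], L, rfl, rfl⟩
      | succ k =>
        obtain ⟨A, B, rfl, hA⟩ := ih (by simpa using h)
        exact ⟨.batch b' :: A, B, rfl, by simp [hA]⟩

@[simp] theorem curView_nil : curView ([] : Ledger S) = 0 := rfl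

@[simp] theorem curView_concat_batch (L : Ledger S) (b : Batch S) :
    curView (L ++ [.batch b]) = curView L := by simp [curView]

@[simp] theorem curView_append_map_batch (L : Ledger S) (bs : List (Batch S)) :
    curView (L ++ bs.map Block.batch) = curView L := by
  induction bs generalizing L with
  | nil => simp
  | cons b bs ih =>
    have := ih (L ++ [.batch b])
    simpa using this

@[simp] theorem curView_concat_newView (L : Ledger S) (n : NewView S) :
    curView (L ++ [.newView n]) = n.view := by simp [curView]

@[simp] theorem curView_append_newView_map_batch (L : Ledger S) (n : NewView S)
    (bs : List (Batch S)) : curView (L ++ .newView n :: bs.map Block.batch) = n.view := by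
  have := curView_append_map_batch (L ++ [.newView n]) bs
  simpa using this

theorem append_eq_append_cons {α : Type*} {L M A B : List α} {x : α} (h : L ++ M = A ++ x :: B) :
    (∃ B', L = A ++ x :: B' ∧ B = B' ++ M) ∨ ∃ A', A = L ++ A' ∧ M = A' ++ x :: B := by
  rcases List.append_eq_append_iff.1 h with ⟨as, h1, h2⟩ | ⟨bs, h1, h2⟩
  · exact .inr ⟨as, h1, h2⟩
  · cases bs with
    | nil => exact .inr ⟨[], by simp_all, by simp_all⟩
    | cons y bs =>
      simp only [List.cons_append, List.cons.injEq] at h2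
      obtain ⟨rfl, rfl⟩ := h2
      exact .inl ⟨bs, h1, rfl⟩

theorem map_batch_eq_append_cons {bs : List (Batch S)} {A B : Ledger S} {x : Block S}
    (h : bs.map Block.batch = A ++ x :: B) :
    ∃ b₁ b b₂, bs = b₁ ++ b :: b₂ ∧ A = b₁.map .batch ∧ x = .batch b ∧ B = b₂.map .batch := by
  obtain ⟨b₁, c, rfl, rfl, h2⟩ := List.map_eq_append_iff.1 h
  obtain ⟨b, b₂, rfl, rfl, rfl⟩ := List.map_eq_cons_iff.1 h2
  exact ⟨b₁, b, b₂, rfl, rfl, rfl, rfl⟩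

/-! ### Injectivity of the digests -/

@[simp] theorem root_concat (L : Ledger S) (x : Block S) :
    root K (L ++ [x]) = K.hash (.entry (root K L) x) := by simp [root]

/-- The hash chain is peeled from its last entry; distinct preimage constructors separate the
genesis digest from that of an extended ledger. -/
theorem root_injective : Function.Injective (root K) := by
  intro L
  induction L using List.reverseRecOn with
  | nil =>
    intro L' h
    rcases List.eq_nil_or_concat L' with rfl | ⟨M, y, rfl⟩
    · rfl
    · rw [List.concat_eq_append, root_concat] at h
      exact absurd (K.hash_injective h) (by simp)
  | append_singleton L x ih =>
    intro L' h
    rcases List.eq_nil_or_concat L' with rfl | ⟨M, y, rfl⟩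
    · rw [root_concat] at h
      exact absurd (K.hash_injective h) (by simp)
    · simp only [List.concat_eq_append, root_concat] at h ⊢
      have := K.hash_injective h
      simp only [Preimage.entry.injEq] at this
      rw [ih this.1, this.2]

theorem Tree.root_injective : Function.Injective (Tree.root K) := by
  intro G
  induction G with
  | leaf x =>
    intro G' h
    cases G' with
    | leaf y => simpa using K.hash_injective h
    | node l r => exact absurd (K.hash_injective h) (by simp)
  | node l r ihl ihr =>
    intro G' h
    cases G' with
    | leaf y => exact absurd (K.hash_injective h) (by simp)
    | node l' r' =>
      have := K.hash_injective h
      simp only [Preimage.node.injEq] at this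
      rw [ihl this.1, ihr this.2]

theorem Body.root_injective : Function.Injective (Body.root K) := by
  intro b b' h
  cases b with
  | txs G =>
    cases b' with
    | txs G' => rw [Tree.root_injective h]
    | checkpoint d => cases G <;> exact absurd (K.hash_injective h) (by simp)
  | checkpoint d =>
    cases b' with
    | txs G => cases G <;> exact absurd (K.hash_injective h) (by simp)
    | checkpoint d' => simpa using K.hash_injective h

/-- A pre-prepare determines the ledger that precedes it, and the entries of its batch. -/
theorem BatchOK.determined {A A' : Ledger S} {b b' : Batch S} (h : BatchOK K A b)
    (h' : BatchOK K A' b') (hpp : b.spp.pp = b'.spp.pp) :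
    A = A' ∧ b.ev = b'.ev ∧ b.body = b'.body := by
  have h1 := h.2.2.1
  have h1' := h'.2.2.1
  rw [hpp, h1'] at h1
  have h1 := K.hash_injective h1
  simp only [Preimage.withEvidence.injEq] at h1
  have h2 := h.2.2.2.1
  rw [hpp, h'.2.2.2.1] at h2
  exact ⟨(root_injective h1.1).symm, h1.2.symm, (Body.root_injective h2).symm⟩

/-! ### Chained ledgers -/

/-- Every batch of the ledger has the form of the next batch after the entries before it. -/
def Chained (K : Crypto S) (L : Ledger S) : Prop :=
  ∀ A b B, L = A ++ .batch b :: B → BatchOK K A b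

/-- `WellFormed` is not closed under prefixes, because reproposed batches are added atomically. This
weaker property is, which is why the structural lemmas rest on it. -/
theorem Chained.of_prefix {L M : Ledger S} (h : Chained K M) (hL : L <+: M) : Chained K L := by
  obtain ⟨C, rfl⟩ := hL
  rintro A b B rfl
  exact h A b (B ++ C) (by simp)

theorem Chained.concat_batch {L : Ledger S} {b : Batch S} (h : Chained K L) (hb : BatchOK K L b) :
    Chained K (L ++ [.batch b]) := by
  intro A b' B hL
  rcases append_eq_append_cons hL with ⟨B', h1, -⟩ | ⟨A', h1, h2⟩
  · exact h A b' B' h1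
  · cases A' with
    | nil =>
      simp only [List.nil_append, List.cons.injEq, Block.batch.injEq] at h2
      rw [h1, ← h2.1, List.append_nil]
      exact hb
    | cons y A' => simp at h2

theorem Reproposes.chained {L : Ledger S} {n : NewView S} {old new : List (Batch S)}
    (h : Chained K L) (hr : Reproposes K L n old new) :
    Chained K (L ++ .newView n :: new.map .batch) := by
  intro A b B hL
  rcases append_eq_append_cons hL with ⟨B', h1, -⟩ | ⟨A', h1, h2⟩
  · exact h A b B' h1
  · cases A' with
    | nil => simp at h2
    | cons y A' =>
      simp only [List.cons_append, List.cons.injEq] at h2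
      obtain ⟨rfl, h2⟩ := h2
      obtain ⟨b₁, c, b₂, rfl, rfl, hc, rfl⟩ := map_batch_eq_append_cons h2
      simp only [Block.batch.injEq] at hc
      subst hc
      rw [h1]
      exact hr.2 b₁ b b₂ rfl

theorem WellFormed.chained {L : Ledger S} (h : WellFormed K L) : Chained K L := by
  induction h with
  | nil => intro A b B h; simp at h
  | batch L b _ hb ih => exact ih.concat_batch hb
  | newView L n old new _ _ hr ih => exact hr.chained (ih.of_prefix (List.prefix_append _ _))

theorem Chained.seq_eq {L A B : Ledger S} {b : Batch S} (h : Chained K L)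
    (hL : L = A ++ .batch b :: B) : b.seq = len A + 1 := (h A b B hL).2.1

theorem Chained.view_eq {L A B : Ledger S} {b : Batch S} (h : Chained K L)
    (hL : L = A ++ .batch b :: B) : b.spp.pp.view = curView A := (h A b B hL).1

theorem Chained.seq_of_getElem? {L : Ledger S} (h : Chained K L) {k : ℕ} {b : Batch S}
    (hb : (batches L)[k]? = some b) : b.seq = k + 1 := by
  obtain ⟨A, B, hL, rfl⟩ := exists_split_of_getElem? hb
  exact h.seq_eq hL

theorem Chained.seq_bounds {L : Ledger S} (h : Chained K L) {b : Batch S} (hb : b ∈ batches L) :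
    1 ≤ b.seq ∧ b.seq ≤ len L := by
  obtain ⟨A, B, rfl⟩ := mem_batches.1 hb
  rw [h.seq_eq rfl]
  simp

theorem Chained.getElem?_batches {L : Ledger S} (h : Chained K L) {b : Batch S}
    (hb : b ∈ batches L) : (batches L)[b.seq - 1]? = some b := by
  obtain ⟨k, hk⟩ := List.mem_iff_getElem?.1 hb
  rw [h.seq_of_getElem? hk]
  exact hk

theorem Chained.eq_of_seq_eq {L : Ledger S} (h : Chained K L) {b b' : Batch S}
    (hb : b ∈ batches L) (hb' : b' ∈ batches L) (hs : b.seq = b'.seq) : b = b' := by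
  have h1 := h.getElem?_batches hb
  rw [hs, h.getElem?_batches hb'] at h1
  exact (Option.some.inj h1).symm

theorem Chained.exists_seq {L : Ledger S} (h : Chained K L) {n : ℕ} (h1 : 1 ≤ n) (hn : n ≤ len L) :
    ∃ A b B, L = A ++ .batch b :: B ∧ b.seq = n := by
  have hlt : n - 1 < (batches L).length := by unfold len at hn; omega
  obtain ⟨A, B, hL, hA⟩ := exists_split_of_getElem? (List.getElem?_eq_getElem hlt)
  exact ⟨A, _, B, hL, by rw [h.seq_eq hL]; omega⟩

/-- A batch is contained in every prefix that is long enough. -/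
theorem Chained.prefix_of_seq_le {W L A : Ledger S} {b : Batch S} (h : Chained K W)
    (hA : A ++ [.batch b] <+: W) (hL : L <+: W) (hb : b.seq ≤ len L) : A ++ [.batch b] <+: L := by
  rcases List.prefix_or_prefix_of_prefix hA hL with h1 | h1
  · exact h1
  · rcases List.prefix_concat_iff.1 h1 with rfl | h2
    · exact List.prefix_rfl
    · have h3 := len_le_of_prefix h2
      have h4 := (h.of_prefix hA).seq_eq (b := b) (A := A) (B := []) rfl
      omega

theorem concat_prefix_of_split {L A B : Ledger S} {x : Block S} (h : L = A ++ x :: B) :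
    A ++ [x] <+: L := ⟨B, by simp [h]⟩

/-! ### Views of well-formed ledgers -/

theorem WellFormed.view_lt {L : Ledger S} (h : WellFormed K L) {A B : Ledger S} {n : NewView S}
    (hL : L = A ++ .newView n :: B) : curView A < n.view := by
  induction h generalizing A B with
  | nil => simp at hL
  | batch L b _ _ ih =>
    rcases append_eq_append_cons hL with ⟨B', h1, -⟩ | ⟨A', -, h2⟩
    · exact ih h1
    · cases A' <;> simp at h2
  | newView L m old new _ hs _ ih =>
    -- An earlier new view lies in the part kept by the truncation, hence also in the ledger before
    -- truncation, to which the induction hypothesis applies.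
    rcases append_eq_append_cons hL with ⟨B', rfl, -⟩ | ⟨A', h1, h2⟩
    · exact ih (B := B' ++ old.map .batch) (by simp)
    · cases A' with
      | nil =>
        simp only [List.nil_append, List.cons.injEq, Block.newView.injEq] at h2
        rw [h1, ← h2.1, List.append_nil]
        exact hs.1
      | cons y A' =>
        simp only [List.cons_append, List.cons.injEq] at h2
        obtain ⟨b₁, c, b₂, -, -, hc, -⟩ := map_batch_eq_append_cons h2.2
        simp at hc

theorem curView_le_append {A B : Ledger S}
    (h : ∀ X n Y, A ++ B = X ++ .newView n :: Y → curView X < n.view) :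
    curView A ≤ curView (A ++ B) := by
  induction B using List.reverseRecOn with
  | nil => simp
  | append_singleton B x ih =>
    have h1 := ih fun X n Y hX => h X n (Y ++ [x]) (by rw [← List.append_assoc, hX]; simp)
    rw [← List.append_assoc]
    cases x with
    | batch b => rwa [curView_concat_batch]
    | newView n =>
      rw [curView_concat_newView]
      exact h1.trans (h (A ++ B) n [] (by simp)).le

/-- Views do not decrease between two prefixes of a well-formed ledger. -/
theorem WellFormed.curView_mono {L A A' : Ledger S} (h : WellFormed K L) (hA : A <+: A')
    (hA' : A' <+: L) : curView A ≤ curView A' := by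
  obtain ⟨B, rfl⟩ := hA
  obtain ⟨C, rfl⟩ := hA'
  exact curView_le_append fun X n Y hX => h.view_lt (A := X) (B := Y ++ C) (by rw [hX]; simp)

theorem WellFormed.curView_le {L A : Ledger S} (h : WellFormed K L) (hA : A <+: L) :
    curView A ≤ curView L := h.curView_mono hA List.prefix_rfl

theorem WellFormed.view_le {L : Ledger S} (h : WellFormed K L) {b : Batch S}
    (hb : b ∈ batches L) : b.spp.pp.view ≤ curView L := by
  obtain ⟨A, B, rfl⟩ := mem_batches.1 hb
  rw [h.chained.view_eq rfl]
  exact h.curView_le (List.prefix_append _ _)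

/-- Views do not decrease along the ledger. -/
theorem WellFormed.view_mono {L : Ledger S} (h : WellFormed K L) {b b' : Batch S}
    (hb : b ∈ batches L) (hb' : b' ∈ batches L) (hs : b.seq ≤ b'.seq) :
    b.spp.pp.view ≤ b'.spp.pp.view := by
  obtain ⟨A, B, hA⟩ := mem_batches.1 hb
  obtain ⟨A', B', hA'⟩ := mem_batches.1 hb'
  have h1 : A ++ [.batch b] <+: A' ++ [.batch b'] :=
    h.chained.prefix_of_seq_le (concat_prefix_of_split hA) (concat_prefix_of_split hA')
      (by rw [h.chained.seq_eq hA'] at hs; simpa using hs)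
  rw [h.chained.view_eq hA, h.chained.view_eq hA']
  rcases List.prefix_concat_iff.1 h1 with h2 | h2
  · rw [(List.append_inj' h2 rfl).1]
  · exact h.curView_mono ((List.prefix_append _ _).trans h2)
      ((List.prefix_append _ _).trans (concat_prefix_of_split hA'))

/-! ### Lineage -/

theorem Selects.length_eq {L : Ledger S} {n : NewView S} {old : List (Batch S)}
    (h : Selects L n old) : old.length = min S.P (len L + old.length) := by
  rcases h.2.2.2.2 with ⟨rfl, rfl, -⟩ | ⟨top, -, h1, -⟩
  · simp
  · exact h1

theorem Reproposes.length_eq {L : Ledger S} {n : NewView S} {old new : List (Batch S)}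
    (h : Reproposes K L n old new) : old.length = new.length := h.1.length_eq

/-- Batches that are proposed again keep their sequence numbers, evidence, and contents. -/
theorem Reproposes.exists_new {L : Ledger S} {n : NewView S} {old new : List (Batch S)}
    (hc : Chained K (L ++ old.map .batch)) (h : Reproposes K L n old new) {o : Batch S}
    (ho : o ∈ old) : ∃ b ∈ new, b.seq = o.seq ∧ b.ev = o.ev ∧ b.body = o.body := by
  obtain ⟨i, hi, rfl⟩ := List.mem_iff_getElem.1 ho
  obtain ⟨hlen, hrel⟩ := List.forall₂_iff_get.1 h.1
  have hi' : i < new.length := hlen ▸ hi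
  have h1 : old = old.take i ++ old[i] :: old.drop (i + 1) := by simp
  have h2 : new = new.take i ++ new[i] :: new.drop (i + 1) := by simp
  refine ⟨new[i], List.getElem_mem hi', ?_, hrel i hi hi'⟩
  have h3 := hc (L ++ (old.take i).map .batch) old[i] ((old.drop (i + 1)).map .batch) (by
    rw [List.append_assoc, ← List.map_cons, ← List.map_append, ← h1])
  rw [(h.2 _ _ _ h2).2.1, h3.2.1]
  simp only [len_append, len_cons_newView, len_map_batch, List.length_take]
  omega

/-- Later view changes may truncate and repropose the same batches repeatedly. Sequence number,
evidence and body survive each time, so only these are tracked in the final ledger. -/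
theorem WellFormed.lineage {L : Ledger S} (h : WellFormed K L) {A B : Ledger S} {n : NewView S}
    (hL : L = A ++ .newView n :: B) : ∃ old, Lineage K L A n old := by
  suffices ∃ old, WellFormed K (A ++ old.map .batch) ∧ Selects A n old ∧
      ∀ o ∈ old, ∃ b ∈ batches L, b.seq = o.seq ∧ b.ev = o.ev ∧ b.body = o.body from
    this.imp fun old ho => ⟨⟨B, hL⟩, ho⟩
  induction h generalizing A B with
  | nil => simp at hL
  | batch L b _ _ ih =>
    rcases append_eq_append_cons hL with ⟨B', h1, -⟩ | ⟨A', -, h2⟩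
    · obtain ⟨old, h3, h4, h5⟩ := ih h1
      refine ⟨old, h3, h4, fun o ho => ?_⟩
      obtain ⟨c, hc, h6⟩ := h5 o ho
      exact ⟨c, by simp [hc], h6⟩
    · cases A' <;> simp at h2
  | newView L m old new hw hs hr ih =>
    rcases append_eq_append_cons hL with ⟨B', rfl, -⟩ | ⟨A', h1, h2⟩
    · obtain ⟨old', h3, h4, h5⟩ := ih (A := A) (B := B' ++ old.map .batch) (by simp)
      refine ⟨old', h3, h4, fun o ho => ?_⟩
      obtain ⟨c, hc, h6, h7, h8⟩ := h5 o ho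
      rw [batches_append, batches_map_batch, List.mem_append] at hc
      rcases hc with hc | hc
      · exact ⟨c, by rw [batches_append]; exact List.mem_append_left _ hc, h6, h7, h8⟩
      -- The successor found so far was itself cut off by the last view change; its own reproposal
      -- takes its place.
      · obtain ⟨b, hb, h9, h10, h11⟩ := hr.exists_new hw.chained hc
        exact ⟨b, by simp [hb], h9.trans h6, h10.trans h7, h11.trans h8⟩
    · cases A' with
      | nil =>
        simp only [List.nil_append, List.cons.injEq, Block.newView.injEq] at h2
        obtain ⟨rfl, -⟩ := h2
        rw [List.append_nil] at h1
        subst h1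
        refine ⟨old, hw, hs, fun o ho => ?_⟩
        obtain ⟨b, hb, h9⟩ := hr.exists_new hw.chained ho
        exact ⟨b, by simp [hb], h9⟩
      | cons y A' =>
        simp only [List.cons_append, List.cons.injEq] at h2
        obtain ⟨b₁, c, b₂, -, -, hc, -⟩ := map_batch_eq_append_cons h2.2
        simp at hc

theorem bodies_prefix_of_forall {L L' : Ledger S} (h : Chained K L) (h' : Chained K L')
    (hb : ∀ b ∈ batches L, ∃ b' ∈ batches L', b'.seq = b.seq ∧ b'.body = b.body) :
    bodies L <+: bodies L' := by
  rw [List.prefix_iff_getElem?]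
  intro i hi
  have hi' : i < (batches L).length := by simpa [len] using hi
  obtain ⟨b', hb', h1, h2⟩ := hb _ (List.getElem_mem hi')
  have h3 := h'.getElem?_batches hb'
  rw [h1, h.seq_of_getElem? (List.getElem?_eq_getElem hi'), Nat.add_sub_cancel] at h3
  simp [bodies, h3, h2]

/-- The abandoned batches have other pre-prepares than the final ledger but the same bodies, and
replay depends on bodies only. -/
theorem Lineage.bodies_prefix {L A : Ledger S} {n : NewView S} {old : List (Batch S)}
    (hL : Chained K L) (h : Lineage K L A n old) :
    bodies (A ++ old.map .batch) <+: bodies L := by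
  obtain ⟨⟨B, rfl⟩, h1, h2, h3⟩ := h
  refine bodies_prefix_of_forall h1.chained hL fun b hb => ?_
  rw [batches_append, batches_map_batch, List.mem_append] at hb
  rcases hb with hb | hb
  · exact ⟨b, by rw [batches_append]; exact List.mem_append_left _ hb, rfl, rfl⟩
  · obtain ⟨c, hc, h4, -, h5⟩ := h3 b hb
    exact ⟨c, hc, h4, h5⟩

/-- The number of batches that a new view proposes again is determined by what it continues. -/
theorem Selects.length_unique {L : Ledger S} {n : NewView S} {old old' : List (Batch S)}
    (hc : Chained K (L ++ old.map .batch)) (hc' : Chained K (L ++ old'.map .batch))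
    (h : Selects L n old) (h' : Selects L n old') : old.length = old'.length := by
  have key : ∀ o o' : List (Batch S), ∀ top top' : Batch S,
      Chained K (L ++ o.map .batch) → Chained K (L ++ o'.map .batch) →
      o.getLast? = some top → o'.getLast? = some top' →
      (∃ vc ∈ n.vcs, vc.pps = o.map Batch.spp) →
      (∀ vc ∈ n.vcs, ∀ q, vc.pps.getLast? = some q → LexLE q.pp top'.spp.pp) →
      o.length ≤ o'.length := by
    intro o o' top top' ho ho' ht ht' hvc hle
    obtain ⟨vc, hvc, hpps⟩ := hvc
    -- The message that reports all of `o` ends in `top`, so `top` is not later than `top'`. Both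
    -- have the view of `L`, so the comparison is one of sequence numbers.
    have h1 := hle vc hvc top.spp (by simp [hpps, ht])
    obtain ⟨u, rfl⟩ := List.getLast?_eq_some_iff.1 ht
    obtain ⟨u', rfl⟩ := List.getLast?_eq_some_iff.1 ht'
    have e1 := ho (L ++ u.map .batch) top [] (by simp)
    have e2 := ho' (L ++ u'.map .batch) top' [] (by simp)
    have v1 := e1.1
    have v2 := e2.1
    have s1 := e1.2.1
    have s2 := e2.2.1
    simp only [curView_append_map_batch, Batch.seq, len_append, len_map_batch] at v1 v2 s1 s2
    simp only [LexLE] at h1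
    simp only [List.length_append, List.length_cons, List.length_nil]
    omega
  rcases h.2.2.2.2 with ⟨rfl, rfl, hn⟩ | ⟨top, ht, h1, hv, hle⟩
  · rcases h'.2.2.2.2 with ⟨-, rfl, -⟩ | ⟨top', ht', h1', ⟨vc, hvc, hp⟩, hle'⟩
    · rfl
    · rw [hn vc hvc] at hp
      rw [List.map_eq_nil_iff.1 hp.symm] at ht'
      simp at ht'
  · rcases h'.2.2.2.2 with ⟨-, rfl, hn⟩ | ⟨top', ht', h1', hv', hle'⟩
    · obtain ⟨vc, hvc, hp⟩ := hv
      rw [hn vc hvc] at hp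
      rw [List.map_eq_nil_iff.1 hp.symm] at ht
      simp at ht
    · exact le_antisymm (key old old' top top' hc hc' ht ht' hv fun vc h q hq => (hle' vc h q hq).1)
        (key old' old top' top hc' hc ht' ht hv' fun vc h q hq => (hle vc h q hq).1)

/-- The batches that are proposed again in a new view are added to the ledger atomically. -/
theorem WellFormed.eq_of_prefix_newView {L X : Ledger S} {n : NewView S} {old new : List (Batch S)}
    (hw : WellFormed K (X ++ old.map .batch)) (hs : Selects X n old)
    (hr : Reproposes K X n old new) (hL : WellFormed K L)
    (hp : L <+: X ++ .newView n :: new.map .batch) (hv : curView L = n.view) :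
    L = X ++ .newView n :: new.map .batch := by
  obtain ⟨C, hC⟩ := hp
  rcases List.append_eq_append_iff.1 hC with ⟨as, rfl, h2⟩ | ⟨bs, rfl, h2⟩
  · have h3 := hw.curView_le (A := L) ⟨as ++ old.map .batch, by simp⟩
    have h4 := hs.1
    simp only [curView_append_map_batch] at h3
    omega
  · cases bs with
    | nil =>
      have h4 := hs.1
      simp only [List.append_nil] at hv
      omega
    | cons y bs =>
      simp only [List.cons_append, List.cons.injEq] at h2
      obtain ⟨rfl, h2⟩ := h2
      obtain ⟨b₁, b₂, rfl, rfl, rfl⟩ := List.map_eq_append_iff.1 h2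
      -- `L` contains the new view too, so it has a lineage with as many batches as `old`; their
      -- bodies must fit into `L`, which leaves nothing to cut off.
      obtain ⟨old', ho⟩ := hL.lineage rfl
      have h5 := ho.2.2.1.length_unique ho.2.1.chained hw.chained hs
      have h6 := (ho.bodies_prefix hL.chained).length_le
      have h7 := hr.length_eq
      simp only [length_bodies, len_append, len_map_batch, len_cons_newView, List.length_append]
        at h6 h7
      have : b₂ = [] := List.length_eq_zero_iff.1 (by omega)
      simp [this]

end

section
variable {S : Sys} {K : Crypto S}

/-! ### Signatures and commitment evidence -/

theorem CommittedBy.of_prefix {L M : Ledger S} {s : ℕ} {c : CommitEv S} (h : CommittedBy K L s c)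
    (hL : L <+: M) : CommittedBy K M s c := by
  obtain ⟨b, hb, b', hb', h⟩ := h
  exact ⟨b, mem_batches_of_prefix hL hb, b', mem_batches_of_prefix hL hb', h⟩

/-- A batch has valid commitment evidence if the signatures in the ledger were verified from the entry
with this evidence on. -/
theorem Chained.committedBy {L : Ledger S} (h : Chained K L) {s : ℕ} (h1 : 1 ≤ s)
    (hs : s + S.P ≤ len L)
    (hsig : ∀ A b B, L = A ++ b :: B → s + S.P ≤ len (A ++ [b]) → SignaturesOK K A b) :
    ∃ c, CommittedBy K L s c := by
  have hP := S.P_pos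
  obtain ⟨A, b', B, hL, hb'⟩ := h.exists_seq (n := s + S.P) (by omega) hs
  have hA : len A + 1 = s + S.P := by rw [← hb', h.seq_eq hL]
  have hAL : A <+: L := ⟨_, hL.symm⟩
  obtain ⟨A', b, B', hA', hb⟩ := (h.of_prefix hAL).exists_seq (n := s) h1 (by omega)
  obtain ⟨c, hc, -⟩ := (h A b' B hL).2.2.2.2.2.2.1 (by omega)
  have hbA : b ∈ batches A := mem_batches.2 ⟨A', B', hA'⟩
  refine ⟨c, b, mem_batches_of_prefix hAL hbA, b', mem_batches.2 ⟨A, B, hL⟩, hb, hb', hc, ?_⟩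
  exact (hsig A (.batch b') B hL (by simp; omega)).2.2 c hc b hbA (by omega)

/-! ### Replay -/

/-- The check at `n` reads only the first `n` bodies, so it transfers between ledgers that agree up
to there. -/
theorem CorrectAt.congr {base n : ℕ} {σ : S.St} {bs bs' : List (Body S)} (h1 : 1 ≤ n)
    (h : bs.take n = bs'.take n) (hc : CorrectAt K base σ bs n) : CorrectAt K base σ bs' n := by
  have hm : ∀ m, m ≤ n → bs'.take m = bs.take m := by
    intro m hm
    have := congrArg (List.take m) h
    rw [List.take_take, List.take_take, min_eq_left hm] at this
    exact this.symm
  have hg : bs'[n - 1]? = bs[n - 1]? := by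
    rw [← List.getElem?_take_of_lt (show n - 1 < n by omega), ← h,
      List.getElem?_take_of_lt (show n - 1 < n by omega)]
  intro b hb
  have := hc b (hg ▸ hb)
  cases b with
  | txs G =>
    intro xs x ys hG
    simp only [hm (n - 1) (by omega)]
    exact this xs x ys hG
  | checkpoint d =>
    simp only [hm (n - S.C) (by omega)]
    exact this

theorem take_eq_take_of_prefix {α : Type*} {l l' : List α} (h : l <+: l') {n : ℕ}
    (hn : n ≤ l.length) : l.take n = l'.take n := by
  obtain ⟨m, rfl⟩ := h
  rw [List.take_append_of_le_length hn]

/-- Replaying from a correct checkpoint gives the same as replaying from genesis. -/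
theorem CorrectAt.of_checkpoint {base n : ℕ} {bs : List (Body S)} (hn : base + S.C ≤ n)
    (h : CorrectAt K base ((bs.take base).foldl Body.run S.init) bs n) :
    CorrectAt K 0 S.init bs n := by
  have hst : ∀ m, base ≤ m → ((bs.take m).drop 0).foldl Body.run S.init =
      ((bs.take m).drop base).foldl Body.run ((bs.take base).foldl Body.run S.init) := by
    intro m hm
    rw [← List.foldl_append, List.drop_zero]
    congr 1
    conv_lhs => rw [← List.take_append_drop base (bs.take m)]
    rw [List.take_take, min_eq_left hm]
  -- This makes `C` positive, so both states that are read, at `n - 1` and at `n - C`, lie at or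
  -- after `base`.
  have hP := S.P_lt_C
  intro b hb
  have := h b hb
  cases b with
  | txs G =>
    intro xs x ys hG
    beta_reduce
    rw [hst (n - 1) (by omega)]
    exact this xs x ys hG
  | checkpoint d =>
    beta_reduce
    rw [hst (n - S.C) (by omega)]
    exact this

/-- If the checkpoint transaction for `base` is correct both for a replay from genesis and for one from
`σ`, then `σ` is the state at `base`. -/
theorem state_eq_of_checkpoint {base : ℕ} {σ : S.St} {bs : List (Body S)} {d : S.Digest}
    (hd : bs[base + S.C - 1]? = some (.checkpoint d))
    (h0 : CorrectAt K 0 S.init bs (base + S.C)) (h1 : CorrectAt K base σ bs (base + S.C)) :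
    σ = (bs.take base).foldl Body.run S.init := by
  have e0 := h0 _ hd
  have e1 := h1 _ hd
  simp only [Nat.add_sub_cancel, List.drop_zero] at e0 e1
  rw [e0] at e1
  have := K.hash_injective e1
  simp only [Preimage.state.injEq] at this
  rw [this, List.drop_eq_nil_of_le (by simp), List.foldl_nil]

/-! ### Verified ledgers and checked batches -/

theorem Verified.of_prefix {base : ℕ} {σ : S.St} {L M : Ledger S} (h : Verified K base σ M)
    (hL : L <+: M) (hb : 0 < base → base + S.C + S.P ≤ len L) : Verified K base σ L := by
  refine ⟨?_, fun n h1 h2 => ?_, ?_⟩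
  · rcases h.1 with h0 | h0
    · exact .inl h0
    · exact .inr ⟨h0.1, h0.2.1, hb h0.1⟩
  · exact (h.2.1 n h1 (h2.trans (len_le_of_prefix hL))).congr (by omega)
      (take_eq_take_of_prefix (bodies_prefix hL) (by simpa using h2)).symm
  · rintro A b B rfl hA
    obtain ⟨C, rfl⟩ := hL
    exact h.2.2 A b (B ++ C) (by simp) hA

theorem Verified.base_le {base : ℕ} {σ : S.St} {L : Ledger S} (h : Verified K base σ L)
    (h0 : 0 < base) : S.C ∣ base ∧ base + S.C + S.P ≤ len L := by
  rcases h.1 with h1 | h1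
  · omega
  · exact h1.2

/-- An invalid signature in a verified ledger lies before the checkpoint transaction for `base`. -/
theorem Verified.lt_of_not_signaturesOK {base : ℕ} {σ : S.St} {L A B : Ledger S} {x : Block S}
    (h : Verified K base σ L) (hL : L = A ++ x :: B) (hx : ¬ SignaturesOK K A x) :
    0 < base ∧ len (A ++ [x]) < base + S.C := by
  by_contra hcon
  exact hx (h.2.2 A x B hL fun h0 => by omega)

theorem Verified.committedBy {base : ℕ} {σ : S.St} {L : Ledger S} (h : Verified K base σ L)
    (hc : Chained K L) (h0 : 0 < base) : ∃ c, CommittedBy K L (base + S.C) c :=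
  hc.committedBy (by omega) (h.base_le h0).2 fun A b B hL hs => h.2.2 A b B hL fun _ => by omega

/-- The batch `b`, which continues the ledger `L`, has been checked before it was signed; it is one of
the last `P` batches of the ledger that was verified. -/
def Checked (K : Crypto S) (L : Ledger S) (b : Batch S) : Prop :=
  ∃ W base σ, L ++ [.batch b] <+: W ∧ Chained K W ∧ Verified K base σ W ∧ len W < b.seq + S.P

theorem Checked.chained {L : Ledger S} {b : Batch S} (h : Checked K L b) :
    Chained K (L ++ [.batch b]) := by
  obtain ⟨W, base, σ, hp, hc, -⟩ := h
  exact hc.of_prefix hp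

theorem Checked.batchOK {L : Ledger S} {b : Batch S} (h : Checked K L b) : BatchOK K L b :=
  h.chained L b [] rfl

/-- If the replay from genesis is correct before a checked batch, then also at this batch. -/
theorem Checked.correctAt {L : Ledger S} {b : Batch S} (h : Checked K L b)
    (hm : ∀ m, 1 ≤ m → m < b.seq → CorrectAt K 0 S.init (bodies (L ++ [.batch b])) m) :
    CorrectAt K 0 S.init (bodies (L ++ [.batch b])) b.seq := by
  have hL := h.batchOK.2.1
  have hlen : (bodies (L ++ [.batch b])).length = b.seq := by simp [hL]
  obtain ⟨W, base, σ, hp, hc, hv, hW⟩ := h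
  have hle := len_le_of_prefix hp
  have htake : ∀ m, m ≤ b.seq → (bodies W).take m = (bodies (L ++ [.batch b])).take m :=
    fun m h => (take_eq_take_of_prefix (bodies_prefix hp) (by omega)).symm
  simp only [len_append, len_cons_batch, len_nil] at hle
  -- With a loaded checkpoint, `base + C + P ≤ len W < b.seq + P`, so even the checkpoint
  -- transaction at `base + C` strictly precedes `b`.
  have hbn : base < b.seq := by
    rcases Nat.eq_zero_or_pos base with h0 | h0
    · omega
    · have := (hv.base_le h0).2
      omega
  have hcor : ∀ n, base < n → n ≤ b.seq → CorrectAt K base σ (bodies (L ++ [.batch b])) n :=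
    fun n h1 h2 => (hv.2.1 n h1 (by omega)).congr (by omega) (htake n h2)
  rcases Nat.eq_zero_or_pos base with h0 | h0
  · have hσ : σ = S.init := by
      rcases hv.1 with h1 | h1
      · exact h1.2
      · omega
    subst h0 hσ
    exact hcor _ hbn le_rfl
  · obtain ⟨hdvd, hlt⟩ := hv.base_le h0
    have hC : 0 < S.C := S.P_pos.trans S.P_lt_C
    have hc' := hc.of_prefix hp
    obtain ⟨A, b', B, hA, hs⟩ := hc'.exists_seq (n := base + S.C) (by omega)
      (by simp only [len_append, len_cons_batch, len_nil]; omega)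
    have hbody := (hc' A b' B hA).2.2.2.2.2.2.2
    have hdvd' : S.C ∣ b'.seq := hs ▸ (Nat.dvd_add_self_right.2 hdvd)
    have hg : (bodies (L ++ [.batch b]))[base + S.C - 1]? = some b'.body := by
      have := hc'.getElem?_batches (mem_batches.2 ⟨A, B, hA⟩)
      rw [hs] at this
      rw [bodies, List.getElem?_map, this]
      rfl
    cases hb' : b'.body with
    | txs G =>
      rw [hb'] at hbody
      exact absurd hdvd' hbody.1
    | checkpoint d =>
      rw [hb'] at hg
      -- The recorded digest is right for both replays: from genesis by assumption, from the loaded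
      -- state because the replica executed that part.
      have hσ := state_eq_of_checkpoint hg (hm _ (by omega) (by omega))
        (hcor _ (by omega) (by omega))
      subst hσ
      exact (hcor _ hbn le_rfl).of_checkpoint (by omega)

/-- Before a checked checkpoint transaction, every invalid signature is followed by an earlier
checkpoint transaction with valid commitment evidence. -/
theorem Checked.committedBy {L A B : Ledger S} {x : Block S} {b : Batch S} (h : Checked K L b)
    (hb : S.C ∣ b.seq) (hL : L = A ++ x :: B) (hx : ¬ SignaturesOK K A x) :
    ∃ s c, S.C ∣ s ∧ len (A ++ [x]) < s ∧ s < b.seq ∧ CommittedBy K L s c := by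
  have hs := h.batchOK.2.1
  obtain ⟨W, base, σ, ⟨D, rfl⟩, hc, hv, hW⟩ := h
  obtain ⟨h0, hlt⟩ := hv.lt_of_not_signaturesOK (A := A) (x := x) (B := B ++ .batch b :: D)
    (by simp [hL]) hx
  obtain ⟨hdvd, hle⟩ := hv.base_le h0
  have hdvd' : S.C ∣ base + S.C := Nat.dvd_add_self_right.2 hdvd
  -- Two distinct multiples of `C` are at least `C > P` apart, so the evidence for the checkpoint
  -- transaction at `base + C` already lies in `L`, before `b`.
  have h1 : S.C ≤ b.seq - (base + S.C) := Nat.le_of_dvd (by omega) (Nat.dvd_sub hb hdvd')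
  have hP := S.P_lt_C
  have hpre : L <+: L ++ [.batch b] ++ D := ⟨.batch b :: D, by simp⟩
  have hv' := hv.of_prefix hpre fun _ => by omega
  obtain ⟨c, hcb⟩ := hv'.committedBy (hc.of_prefix hpre) h0
  exact ⟨base + S.C, c, hdvd', hlt, by omega, hcb⟩

/-! ### Receipts and ledgers -/

/-- The path is read from the root downwards: leaf and node preimages never collide, so each sibling
digest forces a descent into an actual subtree. -/
theorem Tree.mem_leaves_of_path (path : List (Bool × S.Digest)) (x : Tio S) {G : Tree S}
    (h : G.root K = path.foldl
      (fun d g => if g.1 then K.hash (.node g.2 d) else K.hash (.node d g.2)) (K.hash (.leaf x))) :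
    x ∈ G.leaves := by
  induction path using List.reverseRecOn generalizing G with
  | nil =>
    cases G with
    | leaf y =>
      have := K.hash_injective h
      simp only [Preimage.leaf.injEq] at this
      simp [Tree.leaves, this]
    | node l r => exact absurd (K.hash_injective h) (by simp)
  | append_singleton path g ih =>
    rw [List.foldl_append, List.foldl_cons, List.foldl_nil] at h
    cases G with
    | leaf y => split_ifs at h <;> exact absurd (K.hash_injective h) (by simp)
    | node l r =>
      split_ifs at h
      · have := K.hash_injective h
        simp only [Preimage.node.injEq] at this
        simp [Tree.leaves, ih this.2]
      · have := K.hash_injective h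
        simp only [Preimage.node.injEq] at this
        simp [Tree.leaves, ih this.1]

/-- The entry of a receipt belongs to every batch body with the batch root of the receipt. -/
theorem Receipt.tio_mem {R : Receipt S} {b : Body S} (h : b.root K = R.groot K) :
    R.tio ∈ b.tios := by
  cases b with
  | txs G => exact Tree.mem_leaves_of_path R.path R.tio h
  | checkpoint d =>
    rcases List.eq_nil_or_concat R.path with hp | ⟨p, g, hp⟩
    · rw [Receipt.groot, hp] at h
      exact absurd (K.hash_injective h) (by simp)
    · rw [Receipt.groot, hp, List.concat_eq_append, List.foldl_append, List.foldl_cons,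
        List.foldl_nil] at h
      split_ifs at h <;> exact absurd (K.hash_injective h) (by simp)

theorem BatchOK.tio_mem {L : Ledger S} {b : Batch S} (h : BatchOK K L b) {R : Receipt S}
    (hR : b.spp.pp = R.pp K) : R.tio ∈ b.body.tios :=
  Receipt.tio_mem (K := K) (by rw [← h.2.2.2.1, hR]; rfl)

theorem BatchOK.idx {L : Ledger S} {b : Batch S} (h : BatchOK K L b) {k : ℕ} {x : Tio S}
    (hx : b.body.tios[k]? = some x) : x.idx = (tios L).length + 1 + k ∧ x.req.minIdx ≤ x.idx := by
  have h1 := h.2.2.2.2.2.2.2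
  cases hb : b.body with
  | txs G =>
    rw [hb] at h1 hx
    exact h1.2 k x hx
  | checkpoint d => simp [hb, Body.tios] at hx

theorem BatchOK.minIdx_le {L : Ledger S} {b : Batch S} (h : BatchOK K L b) {x : Tio S}
    (hx : x ∈ b.body.tios) : x.req.minIdx ≤ x.idx := by
  obtain ⟨k, hk⟩ := List.mem_iff_getElem?.1 hx
  exact (h.idx hk).2

@[simp] theorem tios_cons_batch (b : Batch S) (L : Ledger S) :
    tios (.batch b :: L) = b.body.tios ++ tios L := by
  simp [tios, bodies]

/-- Entries occur in the ledger at their index. -/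
theorem Chained.getElem?_tios {L : Ledger S} (h : Chained K L) {b : Batch S} (hb : b ∈ batches L)
    {x : Tio S} (hx : x ∈ b.body.tios) :
    1 ≤ x.idx ∧ (tios L)[x.idx - 1]? = some x := by
  obtain ⟨A, B, rfl⟩ := mem_batches.1 hb
  obtain ⟨k, hk⟩ := List.mem_iff_getElem?.1 hx
  have h1 := ((h A b B rfl).idx hk).1
  have hlt : k < b.body.tios.length := (List.getElem?_eq_some_iff.1 hk).1
  refine ⟨by omega, ?_⟩
  rw [tios_append, tios_cons_batch, h1, show (tios A).length + 1 + k - 1 = (tios A).length + k by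
    omega, List.getElem?_append_right (by omega), Nat.add_sub_cancel_left,
    List.getElem?_append_left hlt, hk]

end

section
variable {S : Sys} {K : Crypto S}

/-! ### Invariants of correct replicas -/

/-- The ledger ends with batches that were proposed again when its last view was entered, and `box` proves
that they prepared before. -/
def Entered (K : Crypto S) (L : Ledger S) (box : List (SignedPP S × PrepEv S)) : Prop :=
  ∃ X n old new, L = X ++ .newView n :: new.map .batch ∧ WellFormed K (X ++ old.map .batch) ∧
    Selects X n old ∧ Reproposes K X n old new ∧ ∀ o ∈ old, ∃ e, (o.spp, e) ∈ box

/-- The batch that was signed for view `v` and sequence number `n` is in the ledger `L`, unless `L` is in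
a later view. -/
def Covers (H : Set (Ledger S × Batch S)) (L : Ledger S) (v n : ℕ) : Prop :=
  v ≤ curView L ∧ ∃ x ∈ H, x.2.spp.pp.view = v ∧ x.2.seq = n ∧
    (curView L = v → x.1 ++ [.batch x.2] <+: L)

theorem Covers.mono {H H' : Set (Ledger S × Batch S)} {L : Ledger S} {v n : ℕ}
    (h : Covers H L v n) (hH : H ⊆ H') : Covers H' L v n := by
  obtain ⟨h1, x, hx, h2⟩ := h
  exact ⟨h1, x, hH hx, h2⟩

/-- The ledger is empty or contains a batch of its last view. -/
def EndsInView (L : Ledger S) : Prop := L = [] ∨ ∃ p ∈ pps L, p.view = curView L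

/-- What holds in every reachable state of a correct replica `r`, where `H` is the set of the batches that
it has signed, each with the ledger before it. -/
structure Inv (K : Crypto S) (r : Fin S.N) (nonce : ℕ → ℕ → S.Nonce) (s : RState S)
    (H : Set (Ledger S × Batch S)) : Prop where
  box_valid : ∀ e ∈ s.box, e.2.Valid K e.1
  ledger_wf : WellFormed K s.ledger
  prep_wf : WellFormed K s.prep
  stable_wf : WellFormed K s.stable
  stable_prefix : s.ready → s.stable <+: s.ledger
  stable_view : s.ready → curView s.stable = s.view
  stable_view_lt : ¬ s.ready → curView s.stable < s.view
  stable_cases : s.stable = s.prep ∨ (curView s.prep < curView s.stable ∧ Entered K s.stable s.box)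
  prep_ends : EndsInView s.prep
  prep_box : HasPrepares s.box s.prep
  verified_stable : Verified K s.base s.baseSt s.stable
  verified_ledger : Verified K s.base s.baseSt s.ledger
  checked : ∀ x ∈ H, Checked K x.1 x.2
  ownNonce : ∀ x ∈ H, OwnNonce K r nonce x.2
  view_le : ∀ x ∈ H, x.2.spp.pp.view ≤ s.view
  current : ∀ x ∈ H, x.2.spp.pp.view = s.view → s.ready ∧ x.1 ++ [.batch x.2] <+: s.ledger
  same_view : ∀ x ∈ H, ∀ y ∈ H, x.2.spp.pp.view = y.2.spp.pp.view → x.2.seq ≤ y.2.seq →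
    x.1 ++ [.batch x.2] <+: y.1 ++ [.batch y.2]
  signed : ∀ v n, (v, n) ∈ s.signed → ∃ x ∈ H, x.2.spp.pp.view = v ∧ x.2.seq = n
  sent_order : ∀ m ∈ s.sent, (∃ x ∈ H, m = orderMsg K r nonce x.2) ∨
    (∃ w q, m = .viewChange w r q) ∨ ∃ w d R h, m = .newView w d R h
  sent_viewChange : ∀ w r' q, .viewChange w r' q ∈ s.sent → w ≤ s.view ∧
    ∃ L, WellFormed K L ∧ EndsInView L ∧ q = lastPPs L ∧
      ∀ v n, (v, n) ∈ s.revealed → v < w → Covers H L v n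
  revealed : ∀ v n, (v, n) ∈ s.revealed → Covers H s.prep v n

theorem orderMsg_ne_viewChange {r r' : Fin S.N} {nonce : ℕ → ℕ → S.Nonce} {b : Batch S} {w : ℕ}
    {q : List (SignedPP S)} : orderMsg K r nonce b ≠ .viewChange w r' q := by
  unfold orderMsg
  split_ifs <;> simp

variable {r : Fin S.N} {nonce : ℕ → ℕ → S.Nonce} {s : RState S} {H : Set (Ledger S × Batch S)}

theorem Inv.start : Inv K r nonce (RState.start S) ∅ where
  box_valid := by simp [RState.start]
  ledger_wf := .nil
  prep_wf := .nil
  stable_wf := .nil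
  stable_prefix _ := List.prefix_rfl
  stable_view _ := rfl
  stable_view_lt h := absurd trivial h
  stable_cases := .inl rfl
  prep_ends := .inl rfl
  prep_box := by simp [HasPrepares, RState.start]
  verified_stable := ⟨.inl ⟨rfl, rfl⟩, by simp [RState.start]; omega, by simp [RState.start]⟩
  verified_ledger := ⟨.inl ⟨rfl, rfl⟩, by simp [RState.start]; omega, by simp [RState.start]⟩
  checked := by simp
  ownNonce := by simp
  view_le := by simp
  current := by simp
  same_view := by simp
  signed := by simp [RState.start]
  sent_order := by simp [RState.start]
  sent_viewChange := by simp [RState.start]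
  revealed := by simp [RState.start]

theorem Inv.curView_stable_le (h : Inv K r nonce s H) : curView s.stable ≤ s.view := by
  by_cases hr : s.ready
  · exact (h.stable_view hr).le
  · exact (h.stable_view_lt hr).le

theorem Inv.curView_prep_le (h : Inv K r nonce s H) : curView s.prep ≤ curView s.stable := by
  rcases h.stable_cases with h1 | h1
  · rw [h1]
  · exact h1.1.le

/-- Only an entered view can equal that of `prep`. A stable ledger that differs from `prep` has a
strictly larger view, which would exceed the current one. -/
theorem Inv.prep_current (h : Inv K r nonce s H) (hv : curView s.prep = s.view) :
    s.ready ∧ s.stable = s.prep ∧ s.prep <+: s.ledger := by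
  have h1 := h.curView_stable_le
  have hr : s.ready := by
    by_contra hr
    have h2 := h.stable_view_lt hr
    have h3 := h.curView_prep_le
    omega
  have he : s.stable = s.prep := by
    rcases h.stable_cases with h2 | h2
    · exact h2
    · omega
  exact ⟨hr, he, he ▸ h.stable_prefix hr⟩

theorem Entered.mono {L : Ledger S} {box box' : List (SignedPP S × PrepEv S)}
    (h : Entered K L box) (hb : box ⊆ box') : Entered K L box' := by
  obtain ⟨X, n, old, new, h1, h2, h3, h4, h5⟩ := h
  exact ⟨X, n, old, new, h1, h2, h3, h4, fun o ho => (h5 o ho).imp fun e he => hb he⟩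

theorem HasPrepares.mono {L : Ledger S} {box box' : List (SignedPP S × PrepEv S)}
    (h : HasPrepares box L) (hb : box ⊆ box') : HasPrepares box' L :=
  fun b hb' hl => (h b hb' hl).imp fun _ he => hb he

/-! ### Preservation of the invariant by each protocol step -/

theorem Inv.receive (h : Inv K r nonce s H) {p : SignedPP S} {e : PrepEv S} (he : e.Valid K p) :
    Inv K r nonce { s with box := (p, e) :: s.box } H :=
  { h with
    box_valid := by
      intro x hx
      rcases List.mem_cons.1 hx with rfl | hx
      · exact he
      · exact h.box_valid x hx
    stable_cases := h.stable_cases.imp_right fun h1 =>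
      ⟨h1.1, h1.2.mono (List.subset_cons_self _ _)⟩
    prep_box := h.prep_box.mono (List.subset_cons_self _ _) }

theorem Inv.viewChange (h : Inv K r nonce s H) {w : ℕ} (hw : s.view < w) :
    Inv K r nonce { s with
        view := w
        ready := False
        sent := s.sent ++ [.viewChange w r (lastPPs s.prep)] } H :=
  { h with
    stable_prefix := fun hr => hr.elim
    stable_view := fun hr => hr.elim
    stable_view_lt := fun _ => h.curView_stable_le.trans_lt hw
    view_le := fun x hx => (h.view_le x hx).trans hw.le
    current := fun x hx hv => absurd (h.view_le x hx) (by simp only at hv; omega)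
    sent_order := by
      intro m hm
      rcases List.mem_append.1 hm with hm | hm
      · exact h.sent_order m hm
      · exact .inr (.inl ⟨w, _, List.mem_singleton.1 hm⟩)
    sent_viewChange := by
      intro w' r' q hm
      rcases List.mem_append.1 hm with hm | hm
      · obtain ⟨h1, h2⟩ := h.sent_viewChange w' r' q hm
        exact ⟨h1.trans hw.le, h2⟩
      · have hm := List.mem_singleton.1 hm
        simp only [Msg.viewChange.injEq] at hm
        obtain ⟨rfl, -, rfl⟩ := hm
        -- The ledger behind the report is the prepared one, which covers every batch whose nonce is
        -- disclosed.
        exact ⟨le_rfl, s.prep, h.prep_wf, h.prep_ends, rfl, fun v n hv _ => h.revealed v n hv⟩ }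

theorem Inv.order (h : Inv K r nonce s H) {b : Batch S} (hr : s.ready)
    (hbv : b.spp.pp.view = s.view) (hb : BatchOK K s.ledger b) (hown : OwnNonce K r nonce b)
    (hver : Verified K s.base s.baseSt (s.ledger ++ [.batch b])) :
    Inv K r nonce { s with
        ledger := s.ledger ++ [.batch b]
        sent := s.sent ++ [orderMsg K r nonce b]
        signed := insert (s.view, b.seq) s.signed } (insert (s.ledger, b) H) := by
  have hwf : WellFormed K (s.ledger ++ [.batch b]) := .batch _ _ h.ledger_wf hb
  have hsub : H ⊆ insert (s.ledger, b) H := Set.subset_insert _ _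
  have hcur : ∀ x ∈ insert (s.ledger, b) H, x.2.spp.pp.view = s.view →
      x.1 ++ [.batch x.2] <+: s.ledger ++ [.batch b] := by
    rintro x (rfl | hx) hv
    · exact List.prefix_rfl
    · exact (h.current x hx hv).2.trans (List.prefix_append _ _)
  exact { h with
    ledger_wf := hwf
    stable_prefix := fun hr => (h.stable_prefix hr).trans (List.prefix_append _ _)
    verified_ledger := hver
    checked := by
      rintro x (rfl | hx)
      · refine ⟨_, s.base, s.baseSt, List.prefix_rfl, hwf.chained, hver, ?_⟩
        have h1 := hb.2.1
        have h2 := S.P_pos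
        simp only [len_append, len_cons_batch, len_nil]
        omega
      · exact h.checked x hx
    ownNonce := by
      rintro x (rfl | hx)
      · exact hown
      · exact h.ownNonce x hx
    view_le := by
      rintro x (rfl | hx)
      · exact hbv.le
      · exact h.view_le x hx
    current := fun x hx hv => ⟨hr, hcur x hx hv⟩
    same_view := by
      intro x hx y hy hxy hs
      -- Batches of the current view all lie on the extended local ledger; the new batch is not
      -- involved in any other view.
      by_cases hv : x.2.spp.pp.view = s.view
      · refine hwf.chained.prefix_of_seq_le (hcur x hx hv) (hcur y hy (hxy ▸ hv)) (hs.trans ?_)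
        have h1 := (hwf.chained.of_prefix (hcur y hy (hxy ▸ hv))).seq_eq (b := y.2) (B := []) rfl
        simp [h1]
      · have hx' : x ∈ H := hx.resolve_left (by rintro rfl; exact hv hbv)
        have hy' : y ∈ H := hy.resolve_left (by rintro rfl; exact hv (hxy.trans hbv))
        exact h.same_view x hx' y hy' hxy hs
    signed := by
      rintro v n (hvn | hvn)
      · simp only [Prod.mk.injEq] at hvn
        obtain ⟨rfl, rfl⟩ := hvn
        exact ⟨_, Set.mem_insert _ _, hbv, rfl⟩
      · obtain ⟨x, hx, h1⟩ := h.signed v n hvn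
        exact ⟨x, hsub hx, h1⟩
    sent_order := by
      intro m hm
      rcases List.mem_append.1 hm with hm | hm
      · exact (h.sent_order m hm).imp_left fun ⟨x, hx, h1⟩ => ⟨x, hsub hx, h1⟩
      · exact .inl ⟨_, Set.mem_insert _ _, List.mem_singleton.1 hm⟩
    sent_viewChange := by
      intro w' r' q hm
      rcases List.mem_append.1 hm with hm | hm
      · obtain ⟨h1, L, h2, h3, h4, h5⟩ := h.sent_viewChange w' r' q hm
        exact ⟨h1, L, h2, h3, h4, fun v n hv hw => (h5 v n hv hw).mono hsub⟩
      · exact absurd (List.mem_singleton.1 hm).symm orderMsg_ne_viewChange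
    revealed := fun v n hv => (h.revealed v n hv).mono hsub }

theorem Inv.prepare (h : Inv K r nonce s H) {L : Ledger S} (hr : s.ready) (hp : L <+: s.ledger)
    (hL : WellFormed K L) (hv : curView L = s.view) (hpp : ∃ p ∈ pps L, p.view = s.view)
    (hlen : curView s.prep = s.view → s.prep.length < L.length) (hbox : HasPrepares s.box L) :
    Inv K r nonce { s with
        prep := L
        stable := L
        revealed := s.revealed ∪ {x | x ∈ s.signed ∧ x.1 = s.view ∧ x.2 ≤ len L} } H := by
  -- The stable ledger must only grow, since it has to keep the evidence for the loaded checkpoint.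
  -- If the view was just entered, a shorter `L` would split the atomic group of reproposed batches.
  have hstable : s.stable <+: L := by
    rcases h.stable_cases with h1 | ⟨-, X, n, old, new, h1, h2, h3, h4, -⟩
    · have h2 := h.prep_current (h1 ▸ h.stable_view hr)
      rw [h1]
      exact List.prefix_of_prefix_length_le h2.2.2 hp (hlen (h1 ▸ h.stable_view hr)).le
    · rcases List.prefix_or_prefix_of_prefix (h.stable_prefix hr) hp with h5 | h5
      · exact h5
      · have h6 := h.stable_view hr
        rw [h1] at h5 h6
        rw [curView_append_newView_map_batch] at h6
        rw [h1, h2.eq_of_prefix_newView h3 h4 hL h5 (hv.trans h6.symm)]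
  exact { h with
    prep_wf := hL
    stable_wf := hL
    stable_prefix := fun _ => hp
    stable_view := fun _ => hv
    stable_view_lt := fun hn => absurd hr hn
    stable_cases := .inl rfl
    prep_ends := .inr (hv ▸ hpp)
    prep_box := hbox
    verified_stable := h.verified_ledger.of_prefix hp fun h0 =>
      (h.verified_stable.base_le h0).2.trans (len_le_of_prefix hstable)
    sent_viewChange := by
      intro w r' q hm
      obtain ⟨h1, M, h2, h3, h4, h5⟩ := h.sent_viewChange w r' q hm
      refine ⟨h1, M, h2, h3, h4, fun v n hvn hw => ?_⟩
      rcases hvn with hvn | hvn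
      · exact h5 v n hvn hw
      -- Newly disclosed nonces belong to the current view, which is not below the view of any
      -- message already sent.
      · have := hvn.2.1
        simp only at this
        omega
    revealed := by
      rintro v n (hvn | ⟨h1, h2, h3⟩)
      · obtain ⟨h1, x, hx, h2, h3, h4⟩ := h.revealed v n hvn
        have h5 := h.curView_prep_le
        have h6 := h.curView_stable_le
        refine ⟨by simp only; omega, x, hx, h2, h3, fun h7 => ?_⟩
        simp only at h7
        have h8 : curView s.prep = s.view := by omega
        have h9 := (h.prep_current h8).2.1
        exact (h4 (by omega)).trans (h9 ▸ hstable)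
      · obtain ⟨x, hx, h4, h5⟩ := h.signed v n h1
        simp only at h2 h3
        refine ⟨by simp only; omega, x, hx, h4, h5, fun _ => ?_⟩
        exact h.ledger_wf.chained.prefix_of_seq_le (h.current x hx (h4.trans h2)).2 hp (h5 ▸ h3) }

/-- In an unchanged view the fetched ledger extends the local one; in a later view the claims about
batches of the current view become vacuous. -/
theorem Inv.fetch (h : Inv K r nonce s H) {L : Ledger S} {base : ℕ} {σ : S.St}
    (hL : WellFormed K L) (hv : s.view ≤ curView L)
    (hext : s.ready → curView L = s.view → s.ledger <+: L)
    (hpp : ∃ p ∈ pps L, p.view = curView L) (hbox : HasPrepares s.box L)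
    (hver : Verified K base σ L) :
    Inv K r nonce { s with
        view := curView L
        ready := True
        ledger := L
        prep := L
        stable := L
        base := base
        baseSt := σ } H :=
  { h with
    ledger_wf := hL
    prep_wf := hL
    stable_wf := hL
    stable_prefix := fun _ => List.prefix_rfl
    stable_view := fun _ => rfl
    stable_view_lt := fun hn => absurd trivial hn
    stable_cases := .inl rfl
    prep_ends := .inr hpp
    prep_box := hbox
    verified_stable := hver
    verified_ledger := hver
    view_le := fun x hx => (h.view_le x hx).trans hv
    current := by
      intro x hx hxv
      have h1 := h.view_le x hx
      simp only at hxv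
      obtain ⟨h2, h3⟩ := h.current x hx (by omega)
      exact ⟨trivial, h3.trans (hext h2 (by omega))⟩
    sent_viewChange := by
      intro w r' q hm
      obtain ⟨h1, h2⟩ := h.sent_viewChange w r' q hm
      exact ⟨h1.trans hv, h2⟩
    revealed := by
      intro v n hvn
      obtain ⟨h1, x, hx, h2, h3, h4⟩ := h.revealed v n hvn
      have h5 := h.curView_prep_le
      have h6 := h.curView_stable_le
      refine ⟨by simp only; omega, x, hx, h2, h3, fun h7 => ?_⟩
      simp only at h7
      have h8 := h.prep_current (by omega)
      exact (h4 (by omega)).trans (h8.2.2.trans (hext h8.1 (by omega))) }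

theorem Inv.newView (h : Inv K r nonce s H) {L : Ledger S} {n : NewView S}
    {old new : List (Batch S)} (hr : ¬ s.ready) (hn : n.view = s.view)
    (hwf : WellFormed K (L ++ old.map .batch)) (hsel : Selects L n old)
    (hrep : Reproposes K L n old new) (hbox : ∀ o ∈ old, ∃ e, (o.spp, e) ∈ s.box)
    (hown : ∀ b ∈ new, OwnNonce K r nonce b)
    (hver : Verified K s.base s.baseSt (L ++ .newView n :: new.map .batch))
    {ms : List (Msg S)} (hms : ∀ m ∈ ms, ∃ w d R h, m = .newView w d R h) :
    Inv K r nonce { s with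
        ready := True
        ledger := L ++ .newView n :: new.map .batch
        stable := L ++ .newView n :: new.map .batch
        sent := s.sent ++ ms ++ new.map (orderMsg K r nonce)
        signed := s.signed ∪ {x | x.1 = s.view ∧ ∃ b ∈ new, x.2 = b.seq} }
      (H ∪ {x | ∃ b₁ b b₂, new = b₁ ++ b :: b₂ ∧ x = (L ++ .newView n :: b₁.map .batch, b)}) := by
  set W := L ++ .newView n :: new.map .batch with hW
  set T : Set (Ledger S × Batch S) :=
    {x | ∃ b₁ b b₂, new = b₁ ++ b :: b₂ ∧ x = (L ++ .newView n :: b₁.map .batch, b)} with hT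
  have hWf : WellFormed K W := .newView _ _ _ _ hwf hsel hrep
  have hWv : curView W = s.view := by rw [hW, curView_append_newView_map_batch, hn]
  have hsub : H ⊆ H ∪ T := Set.subset_union_left
  have hTpre : ∀ x ∈ T, x.1 ++ [.batch x.2] <+: W := by
    rintro x ⟨b₁, b, b₂, hb, rfl⟩
    exact ⟨b₂.map .batch, by simp [hW, hb]⟩
  have hTnew : ∀ x ∈ T, x.2 ∈ new := by
    rintro x ⟨b₁, b, b₂, hb, rfl⟩
    simp [hb]
  have hTv : ∀ x ∈ T, x.2.spp.pp.view = s.view := by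
    rintro x ⟨b₁, b, b₂, hb, rfl⟩
    have := (hrep.2 b₁ b b₂ hb).1
    rwa [curView_append_newView_map_batch, hn] at this
  -- Before entering, nothing has been signed in this view, so old and new members of the history
  -- never share a view.
  have hHv : ∀ x ∈ H, x.2.spp.pp.view ≠ s.view := fun x hx hv => hr (h.current x hx hv).1
  have hTex : ∀ b ∈ new, ∃ x ∈ T, x.2 = b := by
    intro b hb
    obtain ⟨b₁, b₂, hb⟩ := List.append_of_mem hb
    exact ⟨_, ⟨b₁, b, b₂, hb, rfl⟩, rfl⟩
  exact { h with
    ledger_wf := hWf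
    stable_wf := hWf
    stable_prefix := fun _ => List.prefix_rfl
    stable_view := fun _ => hWv
    stable_view_lt := fun h1 => absurd trivial h1
    stable_cases := by
      refine .inr ⟨?_, L, n, old, new, rfl, hwf, hsel, hrep, hbox⟩
      simp only [hWv]
      exact h.curView_prep_le.trans_lt (h.stable_view_lt hr)
    verified_stable := hver
    verified_ledger := hver
    checked := by
      rintro x (hx | hx)
      · exact h.checked x hx
      · refine ⟨W, s.base, s.baseSt, hTpre x hx, hWf.chained, hver, ?_⟩
        obtain ⟨b₁, b, b₂, hb, rfl⟩ := hx
        have h1 := (hrep.2 b₁ b b₂ hb).2.1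
        -- At most `P` batches are proposed again, so each of them is among the last `P` of the
        -- verified ledger.
        have h2 := hsel.length_eq
        have h3 := hrep.length_eq
        have h4 : len W = len L + new.length := by simp [hW]
        simp only [len_append, len_cons_newView, len_map_batch] at h1
        simp only
        omega
    ownNonce := by
      rintro x (hx | hx)
      · exact h.ownNonce x hx
      · exact hown _ (hTnew x hx)
    view_le := by
      rintro x (hx | hx)
      · exact h.view_le x hx
      · exact (hTv x hx).le
    current := by
      rintro x (hx | hx) hv
      · exact absurd hv (hHv x hx)
      · exact ⟨trivial, hTpre x hx⟩
    same_view := by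
      rintro x (hx | hx) y (hy | hy) hxy hs
      · exact h.same_view x hx y hy hxy hs
      · exact absurd (hxy.trans (hTv y hy)) (hHv x hx)
      · exact absurd (hxy.symm.trans (hTv x hx)) (hHv y hy)
      · refine hWf.chained.prefix_of_seq_le (hTpre x hx) (hTpre y hy) (hs.trans ?_)
        have h1 := (hWf.chained.of_prefix (hTpre y hy)).seq_eq (b := y.2) (B := []) rfl
        simp [h1]
    signed := by
      rintro v m (hvm | ⟨h1, b, hb, h2⟩)
      · obtain ⟨x, hx, h1⟩ := h.signed v m hvm
        exact ⟨x, hsub hx, h1⟩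
      · obtain ⟨x, hx, rfl⟩ := hTex b hb
        exact ⟨x, .inr hx, (hTv x hx).trans h1.symm, h2.symm⟩
    sent_order := by
      intro m hm
      rcases List.mem_append.1 hm with hm | hm
      · rcases List.mem_append.1 hm with hm | hm
        · exact (h.sent_order m hm).imp_left fun ⟨x, hx, h1⟩ => ⟨x, hsub hx, h1⟩
        · exact .inr (.inr (hms m hm))
      · obtain ⟨b, hb, rfl⟩ := List.mem_map.1 hm
        obtain ⟨x, hx, rfl⟩ := hTex b hb
        exact .inl ⟨x, .inr hx, rfl⟩
    sent_viewChange := by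
      intro w' r' q hm
      rcases List.mem_append.1 hm with hm | hm
      · rcases List.mem_append.1 hm with hm | hm
        · obtain ⟨h1, L, h2, h3, h4, h5⟩ := h.sent_viewChange w' r' q hm
          exact ⟨h1, L, h2, h3, h4, fun v n hv hw => (h5 v n hv hw).mono hsub⟩
        · obtain ⟨w, d, R, h1, h2⟩ := hms _ hm
          simp at h2
      · obtain ⟨b, hb, h1⟩ := List.mem_map.1 hm
        exact absurd h1 orderMsg_ne_viewChange
    revealed := fun v n hv => (h.revealed v n hv).mono hsub }

theorem Inv.step (h : Inv K r nonce s H) {s' : RState S} (hs : Step K r nonce s s') :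
    s.revealed ⊆ s'.revealed ∧ ∃ H', H ⊆ H' ∧ Inv K r nonce s' H' := by
  cases hs with
  | receive p e he => exact ⟨subset_rfl, H, subset_rfl, h.receive he⟩
  | order b hr hv _ hb hown hver =>
    exact ⟨subset_rfl, _, Set.subset_insert _ _, h.order hr hv hb hown hver⟩
  | prepare L hr hp hL hv hpp hlen hbox =>
    exact ⟨Set.subset_union_left, H, subset_rfl, h.prepare hr hp hL hv hpp hlen hbox⟩
  | viewChange w hw => exact ⟨subset_rfl, H, subset_rfl, h.viewChange hw⟩
  | newView L n old new hr hn hwf hsel hrep hbox _ hnew hver =>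
    refine ⟨subset_rfl, _, Set.subset_union_left,
      h.newView hr hn hwf hsel hrep hbox (fun b hb => (hnew b hb).2) hver fun m hm => ?_⟩
    split_ifs at hm
    · exact ⟨_, _, _, _, List.mem_singleton.1 hm⟩
    · simp at hm
  | fetch L base σ hL hv hext hpp hbox hver _ =>
    exact ⟨subset_rfl, H, subset_rfl, h.fetch hL hv hext hpp hbox hver⟩

theorem Inv.steps (h : Inv K r nonce s H) {s' : RState S}
    (hs : Relation.ReflTransGen (Step K r nonce) s s') :
    s.revealed ⊆ s'.revealed ∧ ∃ H', H ⊆ H' ∧ Inv K r nonce s' H' := by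
  induction hs with
  | refl => exact ⟨subset_rfl, H, subset_rfl, h⟩
  | tail _ hs ih =>
    obtain ⟨h1, H₁, h2, h3⟩ := ih
    obtain ⟨h4, H₂, h5, h6⟩ := h3.step hs
    exact ⟨h1.trans h4, H₂, h2.trans h5, h6⟩

end

section
variable {S : Sys} {K : Crypto S} {r : Fin S.N} {nonce : ℕ → ℕ → S.Nonce} {s : RState S}
  {H : Set (Ledger S × Batch S)}

/-! ### What a correct replica has signed -/

theorem Inv.eq_of_seq_eq (h : Inv K r nonce s H) {x y : Ledger S × Batch S} (hx : x ∈ H)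
    (hy : y ∈ H) (hv : x.2.spp.pp.view = y.2.spp.pp.view) (hs : x.2.seq = y.2.seq) : x = y := by
  have h1 := h.same_view x hx y hy hv hs.le
  have h2 := h.same_view y hy x hx hv.symm hs.ge
  have h3 := List.append_inj' (h1.eq_of_length_le h2.length_le) rfl
  simp only [List.cons.injEq, Block.batch.injEq, and_true] at h3
  exact Prod.ext h3.1 h3.2

/-- A verified message was really sent, and its form shows that it came from ordering a batch. A
backup's message identifies the pre-prepare, and its nonce, only through injective hashes. -/
theorem Inv.exists_of_prepEv (h : Inv K r nonce s H)
    (hu : ∀ m σ, K.verify r m σ → m ∈ s.sent) {p : SignedPP S} {e : PrepEv S} (he : e.Valid K p)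
    (hr : r ∈ e.signers) : ∃ x ∈ H, x.2.spp.pp = p.pp ∧
      (r ≠ S.primary p.pp.view →
        e.hnonce r = K.hash (.nonce (nonce p.pp.view p.pp.seq))) := by
  by_cases hp : r = S.primary p.pp.view
  · have hm := hu _ _ (hp ▸ he.2.1)
    rcases h.sent_order _ hm with ⟨x, hx, h1⟩ | ⟨w, q, h1⟩ | ⟨w, d, R, g, h1⟩
    · refine ⟨x, hx, ?_, fun hn => absurd hp hn⟩
      unfold orderMsg at h1
      split_ifs at h1
      simp only [Msg.prePrepare.injEq] at h1
      exact h1.symm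
    · simp at h1
    · simp at h1
  · have hm := hu _ _ (he.2.2 r hr hp)
    rcases h.sent_order _ hm with ⟨x, hx, h1⟩ | ⟨w, q, h1⟩ | ⟨w, d, R, g, h1⟩
    · unfold orderMsg at h1
      split_ifs at h1
      simp only [Msg.prepare.injEq, true_and] at h1
      have h2 := K.hash_injective h1.2
      simp only [Preimage.signedPP.injEq] at h2
      exact ⟨x, hx, by rw [h2], fun _ => by rw [h1.1, h2]; rfl⟩
    · simp at h1
    · simp at h1

/-- A disclosed nonce must be the replica's own for that view and sequence number: a backup
committed to its hash in the prepare message, the primary in the pre-prepare. -/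
theorem Inv.exists_of_commitEv (h : Inv K r nonce s H)
    (hu : ∀ m σ, K.verify r m σ → m ∈ s.sent) {p : SignedPP S} {c : CommitEv S}
    (hc : c.Valid K p) (hr : r ∈ c.signers) :
    ∃ x ∈ H, x.2.spp.pp = p.pp ∧ c.nonce r = nonce p.pp.view p.pp.seq := by
  obtain ⟨x, hx, h1, h2⟩ := h.exists_of_prepEv hu hc.1 hr
  refine ⟨x, hx, h1, ?_⟩
  have h3 : K.hash (.nonce (c.nonce r)) = K.hash (.nonce (nonce p.pp.view p.pp.seq)) := by
    by_cases hp : r = S.primary p.pp.view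
    · have h4 := hc.2 (hp ▸ hr)
      have h5 := h.ownNonce x hx (by rw [h1]; exact hp)
      rw [← hp] at h4
      rw [h4, ← h1, h5]
      rfl
    · exact h2 hp
  simpa using K.hash_injective h3

/-! ### Ledgers that contain a given pre-prepare -/

/-- The pre-prepare of `b` pins everything before it, so a ledger containing it contains all of `A`,
hence every earlier batch. -/
theorem Chained.mem_pps_of_prefix {L A A' : Ledger S} {b b' : Batch S} (h : Chained K L)
    (hb : BatchOK K A b) (hL : b.spp.pp ∈ pps L) (hp : A' ++ [.batch b'] <+: A ++ [.batch b]) :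
    b'.spp.pp ∈ pps L := by
  obtain ⟨c, hc, hcb⟩ := mem_pps.1 hL
  obtain ⟨D, B, hD⟩ := mem_batches.1 hc
  have h1 := ((h D c B hD).determined hb hcb).1
  rcases List.prefix_concat_iff.1 hp with h2 | h2
  · have h3 := List.append_inj' h2 rfl
    simp only [List.cons.injEq, Block.batch.injEq, and_true] at h3
    rwa [h3.2]
  · have h3 : A' ++ [.batch b'] <+: L := h2.trans (h1 ▸ ⟨_, hD.symm⟩)
    exact LPBFT.mem_pps_of_prefix h3 (mem_pps.2 ⟨b', by simp, rfl⟩)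

theorem Chained.bodies_prefix_of_mem_pps {L A : Ledger S} {b : Batch S} (h : Chained K L)
    (hb : BatchOK K A b) (hL : b.spp.pp ∈ pps L) : bodies (A ++ [.batch b]) <+: bodies L := by
  obtain ⟨c, hc, hcb⟩ := mem_pps.1 hL
  obtain ⟨D, B, rfl⟩ := mem_batches.1 hc
  obtain ⟨rfl, -, h2⟩ := (h D c B rfl).determined hb hcb
  refine ⟨bodies B, ?_⟩
  simp [bodies, h2]

/-- Evidence may refer to a pre-prepare of an earlier view; through the lineage, the history its
signer executed still agrees body by body with the audited ledger. -/
theorem Concerns.bodies_prefix {L A : Ledger S} {b : Batch S} {n : ℕ} {q : SignedPP S}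
    (h : Chained K L) (hb : BatchOK K A b) (hq : b.spp.pp = q.pp) (hcon : Concerns K L n q) :
    b.seq = n ∧ bodies (A ++ [.batch b]) <+: bodies L := by
  refine ⟨by rw [Batch.seq, hq]; exact hcon.1, ?_⟩
  rcases hcon.2 with h1 | ⟨A', nv, old, hl, o, ho, rfl⟩
  · obtain ⟨c, hc, rfl⟩ := mem_signedPPs.1 h1
    exact h.bodies_prefix_of_mem_pps hb (mem_pps.2 ⟨c, hc, hq.symm⟩)
  · exact (hl.2.1.chained.bodies_prefix_of_mem_pps hb
      (mem_pps.2 ⟨o, by simp [ho], hq.symm⟩)).trans (hl.bodies_prefix h)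

/-! ### The ledger packages of correct replicas -/

theorem Inv.concerns (h : Inv K r nonce s H) {n : ℕ} (h1 : 1 ≤ n) (hn : n ≤ len s.stable)
    (hP : len s.stable < n + S.P) : ∃ e ∈ s.box, Concerns K s.stable n e.1 := by
  rcases h.stable_cases with h2 | ⟨-, X, m, old, new, h2, hwf, hsel, hrep, hbox⟩
  · obtain ⟨A, b, B, hL, rfl⟩ := h.stable_wf.chained.exists_seq h1 hn
    have hb := mem_batches.2 ⟨A, B, hL⟩
    obtain ⟨e, he⟩ := h.prep_box b (h2 ▸ hb) (h2 ▸ hP)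
    exact ⟨_, he, rfl, .inl (mem_signedPPs.2 ⟨b, hb, rfl⟩)⟩
  · have h3 := hsel.length_eq
    have h4 := hrep.length_eq
    have h5 : len s.stable = len X + new.length := by simp [h2]
    obtain ⟨A, o, B, hL, rfl⟩ := hwf.chained.exists_seq (n := n) h1 (by simp; omega)
    have ho := mem_batches.2 ⟨A, B, hL⟩
    rw [batches_append, batches_map_batch, List.mem_append] at ho
    -- If `old` has `P` batches they are the last `P`; if it has fewer, nothing precedes them.
    have ho : o ∈ old := by
      refine ho.resolve_left fun ho => ?_
      have := (hwf.chained.of_prefix (List.prefix_append _ _)).seq_bounds ho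
      omega
    obtain ⟨e, he⟩ := hbox o ho
    refine ⟨_, he, rfl, .inr ⟨X, m, old, ⟨⟨_, h2⟩, hwf, hsel, fun o ho => ?_⟩, o, ho, rfl⟩⟩
    obtain ⟨b, hb, h6⟩ := hrep.exists_new hwf.chained ho
    exact ⟨b, by simp [h2, hb], h6⟩

/-- An unchecked invalid signature can only precede the checkpoint transaction at `base + C`, whose
commitment evidence the replica did verify. -/
theorem Inv.admissible (h : Inv K r nonce s H) {R : Receipt S} (hv : R.view ≤ curView s.stable)
    (hR : curView s.stable = R.view → R.pp K ∈ pps s.stable) : Admissible K R s.package := by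
  refine ⟨h.stable_wf, hv, hR, h.box_valid, fun n h1 h2 h3 => h.concerns h1 h2 h3, ?_⟩
  intro A b B hL hb
  obtain ⟨h0, hlt⟩ := h.verified_stable.lt_of_not_signaturesOK hL hb
  obtain ⟨c, hc⟩ := h.verified_stable.committedBy h.stable_wf.chained h0
  exact ⟨s.base + S.C, c, Nat.dvd_add_self_right.2 (h.verified_stable.base_le h0).1, hlt, hc⟩

/-! ### View changes -/

theorem getLast?_lastPPs {L : Ledger S} {A : Ledger S} {b : Batch S} {B : Ledger S}
    (h : Chained K L) (hL : L = A ++ .batch b :: B) (hb : b.seq = len L) :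
    (lastPPs L).getLast? = some b.spp := by
  have h1 := h.getElem?_batches (mem_batches.2 ⟨A, B, hL⟩)
  have h2 := h.seq_bounds (mem_batches.2 ⟨A, B, hL⟩)
  have hP := S.P_pos
  have hlen : (signedPPs L).length = len L := by simp [signedPPs, len]
  rw [lastPPs, List.getLast?_drop, if_neg (by omega), List.getLast?_eq_getElem?, hlen, ← hb,
    signedPPs, List.getElem?_map, h1]
  rfl

/-- The report of a prepared ledger that covers the batch of a receipt is consistent with it. -/
theorem Covers.reports {L M : Ledger S} {q : PrePrepare S} {vc : ViewChange S}
    (hc : Covers H L q.view q.seq) (hH : ∀ x ∈ H, x.2.spp.pp.view = q.view → x.2.seq = q.seq →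
      x.2.spp.pp = q) (hL : WellFormed K L) (he : EndsInView L) (hM : Chained K M)
    (hvc : vc.pps = lastPPs L) : Reports M vc q := by
  obtain ⟨hv, x, hx, h1, h2, h3⟩ := hc
  have hxq := hH x hx h1 h2
  rcases he with rfl | ⟨p, hp, hpv⟩
  · have := h3 (by simpa [eq_comm] using hv)
    simp at this
  obtain ⟨b, hb, rfl⟩ := mem_pps.1 hp
  have hbs := hL.chained.seq_bounds hb
  -- The last batch `z` ends the report. Views do not decrease along the ledger, so its view is that
  -- of `L`.
  obtain ⟨A, z, B, hA, hz⟩ := hL.chained.exists_seq (n := len L) (by omega) le_rfl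
  have hzL := mem_batches.2 ⟨A, B, hA⟩
  have hzv : z.spp.pp.view = curView L :=
    le_antisymm (hL.view_le hzL) (hpv ▸ hL.view_mono hb hzL (by omega))
  have hxz : curView L = q.view → x.1 ++ [.batch x.2] <+: A ++ [.batch z] := by
    intro hq
    refine hL.chained.prefix_of_seq_le (h3 hq) (concat_prefix_of_split hA) ?_
    have h4 := hL.chained.seq_eq hA
    have h5 := len_le_of_prefix (h3 hq)
    have h6 := (hL.chained.of_prefix (h3 hq)).seq_eq (b := x.2) (B := []) rfl
    simp only [len_append, len_cons_batch, len_nil] at h5 ⊢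
    omega
  refine ⟨z.spp, hvc ▸ getLast?_lastPPs hL.chained hA hz, ?_, fun hq hzM => ?_⟩
  · rcases hv.lt_or_eq with hlt | heq
    · exact .inl (hzv ▸ hlt)
    · refine .inr ⟨by rw [hzv, heq], ?_⟩
      have h5 := len_le_of_prefix (h3 heq.symm)
      have h6 := (hL.chained.of_prefix (h3 heq.symm)).seq_eq (b := x.2) (B := []) rfl
      simp only [len_append, len_cons_batch, len_nil, Batch.seq] at h5 h6 hz h2
      omega
  · rw [← hxq]
    -- In the same view the receipt's batch precedes `z` or equals it, and the pre-prepare of `z`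
    -- brings its whole past into `M`.
    exact hM.mem_pps_of_prefix (hL.chained A z B hA) hzM (hxz (by rw [← hzv, hq]))

/-! ### Correct replicas are not blamed -/

theorem Execution.exists_inv (E : Execution K) (hr : r ∈ E.correct) :
    ∃ H H', Inv K r (E.nonce r) (E.atAudit r) H ∧ Inv K r (E.nonce r) (E.final r) H' ∧ H ⊆ H' ∧
      (E.atAudit r).revealed ⊆ (E.final r).revealed := by
  obtain ⟨-, H, -, h1⟩ := Inv.start.steps (E.run_atAudit r hr)
  obtain ⟨h2, H', h3, h4⟩ := h1.steps (E.run_final r hr)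
  exact ⟨H, H', h1, h4, h3, h2⟩

theorem Execution.revealed_of_receipt (E : Execution K) {Rs : Finset (Receipt S)}
    (hvalid : ∀ R ∈ Rs, R.Valid K) (hcoll : E.Collected Rs) (hr : r ∈ E.correct) {R : Receipt S}
    (hR : R ∈ Rs) (hrR : r ∈ R.signers) (h : Inv K r (E.nonce r) (E.final r) H) :
    (R.view, R.seq) ∈ (E.atAudit r).revealed ∧ ∃ x ∈ H, x.2.spp.pp = R.pp K := by
  obtain ⟨x, hx, h1, h2⟩ := h.exists_of_commitEv (E.unforgeable r hr) (hvalid R hR) hrR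
  exact ⟨hcoll R hR r hrR hr _ _ h2, x, hx, h1⟩

/-- Two points of the run matter: packages and disclosed nonces refer to the state at the audit,
while signatures shown to the auditor are only known to have been made by the end. -/
theorem not_blamed (E : Execution K) {Rs : Finset (Receipt S)} (hvalid : ∀ R ∈ Rs, R.Valid K)
    (hcoll : E.Collected Rs) {R₀ : Receipt S} (hR₀ : R₀ ∈ Rs)
    {resp : Fin S.N → Option (Package S)}
    (hresp : ∀ r ∈ E.correct, ∀ p, resp r = some p → p = (E.atAudit r).package)
    (hr : r ∈ E.correct) : ¬ Blamed K Rs R₀ resp r := by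
  obtain ⟨H₀, H, h₀, h, hsub, hrev⟩ := E.exists_inv hr
  have hu := E.unforgeable r hr
  have hrec := fun R hR hrR => E.revealed_of_receipt hvalid hcoll hr (R := R) hR hrR h
  intro hbl
  cases hbl with
  | minIndex R hR hrR hidx =>
    obtain ⟨-, x, hx, h1⟩ := hrec R hR hrR
    have h2 := (h.checked x hx).batchOK
    have := h2.minIdx_le (h2.tio_mem h1)
    omega
  | badPackage p hrR hp hadm =>
    obtain rfl := hresp r hr p hp
    obtain ⟨h1, y, hy, h2⟩ := hrec R₀ hR₀ hrR
    obtain ⟨h3, x, hx, h4, h5, h6⟩ := h₀.revealed _ _ h1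
    have hle := h₀.curView_prep_le
    refine hadm (h₀.admissible (h3.trans hle) fun hv => ?_)
    -- A view entered after the last prepared batch would exceed the view of `prep`, which is
    -- already at least that of the receipt.
    have hst : (E.atAudit r).stable = (E.atAudit r).prep := by
      rcases h₀.stable_cases with h7 | h7
      · exact h7
      · omega
    have hxy : x = y := h.eq_of_seq_eq (hsub hx) hy (by rw [h4, h2]; rfl)
      (by rw [h5, Batch.seq, h2]; rfl)
    have h8 := h6 (hst ▸ hv)
    rw [hst, ← h2, ← hxy]
    exact mem_pps_of_prefix h8 (mem_pps.2 ⟨x.2, by simp, rfl⟩)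
  | badSignature r' p A B b n c _ _ hadm hL hb hn hlt hc hfirst hrc =>
    obtain ⟨bs, hbs, b', -, hs, -, -, hcv⟩ := hc
    obtain ⟨x, hx, h1, -⟩ := h.exists_of_commitEv hu hcv hrc
    have hch := hadm.1.chained
    obtain ⟨A', B', hA'⟩ := mem_batches.1 hbs
    have hx' := h.checked x hx
    obtain ⟨hxA, -⟩ := hx'.batchOK.determined (hch A' bs B' hA') h1
    have hseq : x.2.seq = n := by rw [← hs, Batch.seq, h1]; rfl
    -- The invalid entry strictly precedes the signed checkpoint transaction, so it lies in the very
    -- ledger on top of which the replica signed.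
    have hAA : A ++ [b] <+: A' := by
      have h2 := hch.seq_eq hA'
      have h3 : A ++ [b] <+: A' ++ [.batch bs] := by
        rcases List.prefix_or_prefix_of_prefix (concat_prefix_of_split hL)
          (concat_prefix_of_split hA') with h3 | h3
        · exact h3
        · have := len_le_of_prefix h3
          simp only [len_append, len_cons_batch, len_nil] at this hlt
          omega
      rcases List.prefix_concat_iff.1 h3 with h4 | h4
      · rw [h4] at hlt
        simp only [len_append, len_cons_batch, len_nil] at hlt
        omega
      · exact h4
    obtain ⟨D, hD⟩ := hAA
    obtain ⟨s', c', h5, h6, h7, h8⟩ := hx'.committedBy (A := A) (x := b) (B := D) (hseq ▸ hn)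
      (by rw [hxA, ← hD]; simp) hb
    exact hfirst s' c' h5 h6 (hseq ▸ h7) (h8.of_prefix (hxA ▸ ⟨_, hA'.symm⟩))
  | sameView r' p R R' _ _ hadm hR hR' hv hs hin hout hrR hrR' =>
    obtain ⟨-, x, hx, hxR⟩ := hrec R hR hrR
    obtain ⟨-, y, hy, hyR⟩ := hrec R' hR' hrR'
    have h1 := h.same_view x hx y hy (by rw [hxR, hyR]; exact hv)
      (by rw [Batch.seq, Batch.seq, hxR, hyR]; exact hs)
    exact hout (hxR ▸ hadm.1.chained.mem_pps_of_prefix (h.checked y hy).batchOK (hyR ▸ hin) h1)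
  | viewChange r' p R A n old vc _ _ hadm hR hrR hl hlt hvc hsender hsig hrep =>
    obtain ⟨hrv, y, hy, hyR⟩ := hrec R hR hrR
    obtain ⟨-, L, hL, hend, hpps, hcov⟩ := h.sent_viewChange _ _ _ (hu _ _ hsig)
    have hview := hl.2.2.1.2.2.2.1 vc hvc
    have hc := hcov R.view R.seq (hrev hrv) (hview ▸ hlt)
    refine hrep (Covers.reports (q := R.pp K) hc (fun x hx h1 h2 => ?_) hL hend hl.2.1.chained hpps)
    rw [h.eq_of_seq_eq hx hy (by rw [h1, hyR]) (by rw [h2, Batch.seq, hyR]), hyR]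
  | replay r' p n q e _ _ hadm h1 hn hfail hbefore hcon he _ hre =>
    obtain ⟨x, hx, hxq, -⟩ := h.exists_of_prepEv hu he hre
    have hx' := h.checked x hx
    obtain ⟨rfl, hpre⟩ := hcon.bodies_prefix hadm.1.chained hx'.batchOK hxq
    have hlen : x.2.seq ≤ (bodies (x.1 ++ [.batch x.2])).length := by
      simp [hx'.batchOK.2.1]
    refine hfail ((hx'.correctAt fun m hm1 hm2 => ?_).congr h1
      (take_eq_take_of_prefix hpre hlen))
    exact (hbefore m hm1 hm2).congr hm1 (take_eq_take_of_prefix hpre (by omega)).symm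

end

section
variable {S : Sys} {K : Crypto S}

/-! ### Quorums -/

theorem Sys.f_lt_quorum (S : Sys) : S.f + 1 ≤ S.quorum := by
  have := S.N_pos
  unfold Sys.quorum Sys.f
  omega

/-- Two quorums share at least `2 (N - f) - N = N - 2 f` replicas, and `3 f < N`. -/
theorem Sys.quorum_inter {A B : Finset (Fin S.N)} (hA : S.quorum ≤ A.card)
    (hB : S.quorum ≤ B.card) : S.f + 1 ≤ (A ∩ B).card := by
  have h1 := Finset.card_union_add_card_inter A B
  have h2 : (A ∪ B).card ≤ S.N := by simpa using Finset.card_le_univ (A ∪ B)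
  have := S.N_pos
  unfold Sys.quorum Sys.f at *
  omega

/-! ### Replaying a correct ledger -/

theorem foldl_body_run (σ : S.St) (bs : List (Body S)) :
    bs.foldl Body.run σ = (bs.flatMap Body.tios).foldl Tio.run σ := by
  induction bs generalizing σ with
  | nil => rfl
  | cons b bs ih => simp [ih, Body.run]

/-- If a batch of the ledger is correct, the requests in the ledger produce its results. -/
theorem Chained.produces {L : Ledger S} (h : Chained K L) {b : Batch S} (hb : b ∈ batches L)
    (hc : CorrectAt K 0 S.init (bodies L) b.seq) {x : Tio S} (hx : x ∈ b.body.tios) :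
    Produces ((tios L).map Tio.req) x := by
  obtain ⟨h1, h2⟩ := h.getElem?_tios hb hx
  refine ⟨h1, by simp [h2], ?_⟩
  have hg : (bodies L)[b.seq - 1]? = some b.body := by
    rw [bodies, List.getElem?_map, h.getElem?_batches hb]
    rfl
  have h3 := hc _ hg
  obtain ⟨A, B, hL⟩ := mem_batches.1 hb
  have hA : ((bodies L).take (b.seq - 1)).foldl Body.run S.init =
      (tios A).foldl Tio.run S.init := by
    rw [foldl_body_run, h.seq_eq hL, Nat.add_sub_cancel, hL, bodies_append,
      List.take_left' (length_bodies A)]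
    rfl
  obtain ⟨k, hk⟩ := List.mem_iff_getElem?.1 hx
  have hidx := ((h A b B hL).idx hk).1
  obtain ⟨hlt, hxk⟩ := List.getElem?_eq_some_iff.1 hk
  have hsplit : b.body.tios = b.body.tios.take k ++ x :: b.body.tios.drop (k + 1) := by
    rw [← hxk]
    simp
  have htake : (tios L).take (x.idx - 1) = tios A ++ b.body.tios.take k := by
    rw [hL, tios_append, tios_cons_batch, hidx,
      show (tios A).length + 1 + k - 1 = (tios A).length + k by omega, List.take_length_add_append,
      List.take_append_of_le_length hlt.le]
  have hrun : (((tios L).map Tio.req).take (x.idx - 1)).foldl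
      (fun σ t => (S.exec t.client t.cmd σ).1) S.init =
      (b.body.tios.take k).foldl Tio.run ((tios A).foldl Tio.run S.init) := by
    rw [← List.map_take, List.foldl_map, htake, List.foldl_append]
    rfl
  rw [hrun]
  cases hbody : b.body with
  | checkpoint d => simp [hbody, Body.tios] at hx
  | txs G =>
    rw [hbody] at h3 hsplit
    have h4 := h3 _ _ _ hsplit
    beta_reduce at h4
    rwa [List.drop_zero, hA] at h4

/-! ### The auditor finds enough misbehaving replicas -/

/-- The first new view of the ledger beyond the view `v`. -/
theorem exists_first_newView {L : Ledger S} {v : ℕ} (h : v < curView L) :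
    ∃ A n B, L = A ++ .newView n :: B ∧ v < n.view ∧ curView A ≤ v := by
  induction L using List.reverseRecOn with
  | nil => simp at h
  | append_singleton L x ih =>
    by_cases hv : v < curView L
    · obtain ⟨A, n, B, rfl, h1⟩ := ih hv
      exact ⟨A, n, B ++ [x], by simp, h1⟩
    · cases x with
      | batch b =>
        rw [curView_concat_batch] at h
        exact absurd h hv
      | newView n =>
        rw [curView_concat_newView] at h
        exact ⟨L, n, [], rfl, h, not_lt.1 hv⟩

/-- If the sender of some view-change message consistently reports a pre-prepare `q` whose view is not
older than the ledger that the new view continued, then this ledger contains `q`. -/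
theorem Lineage.mem_pps_of_reports {L A : Ledger S} {n : NewView S} {old : List (Batch S)}
    {vc : ViewChange S} {q : PrePrepare S} (h : Lineage K L A n old) (hvc : vc ∈ n.vcs)
    (hv : curView A ≤ q.view) (hr : Reports (A ++ old.map .batch) vc q) :
    q ∈ pps (A ++ old.map .batch) := by
  obtain ⟨p, hp, hle, himp⟩ := hr
  rcases h.2.2.1.2.2.2.2 with ⟨-, -, hn⟩ | ⟨top, ht, -, -, hmax⟩
  · simp [hn vc hvc] at hp
  · obtain ⟨h1, h2⟩ := hmax vc hvc p hp
    obtain ⟨u, rfl⟩ := List.getLast?_eq_some_iff.1 ht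
    have h3 := h.2.1.chained.view_eq (A := A ++ u.map .batch) (b := top) (B := []) (by simp)
    rw [curView_append_map_batch] at h3
    -- The views of `q`, `p` and `top` increase weakly, starting at no less than that of `A` and
    -- ending exactly there; so all coincide.
    simp only [LexLE] at hle h1
    exact himp (by omega) (h2 (by omega))

theorem le_card_blamed (E : Execution K) {Rs : Finset (Receipt S)}
    (hvalid : ∀ R ∈ Rs, R.Valid K) (hviol : ¬ E.Linearizable Rs) {R₀ : Receipt S}
    (hR₀ : IsLatest Rs R₀) {resp : Fin S.N → Option (Package S)}
    (hcard : S.f + 1 ≤ (responders R₀ resp).card) :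
    open Classical in S.f + 1 ≤ (Finset.univ.filter (Blamed K Rs R₀ resp)).card := by
  classical
  by_contra hlt
  -- With at most `f` replicas blamed, any `f + 1` include an unblamed one. It need not be correct;
  -- the absence of each ground for blame is all that is used.
  have hno : ∀ A : Finset (Fin S.N), S.f + 1 ≤ A.card → ∃ r ∈ A, ¬ Blamed K Rs R₀ resp r := by
    intro A hA
    by_contra! hall
    exact hlt (hA.trans (Finset.card_le_card fun r hr => by simp [hall r hr]))
  have hsig : ∀ R ∈ Rs, S.quorum ≤ R.signers.card := fun R hR => (hvalid R hR).1.1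
  obtain ⟨r', hr', hnb⟩ := hno _ hcard
  obtain ⟨hr'R, hsome⟩ := Finset.mem_filter.1 hr'
  obtain ⟨p, hp⟩ := Option.isSome_iff_exists.1 hsome
  have hadm : Admissible K R₀ p := by
    by_contra hadm
    exact hnb (.badPackage r' p hr'R hp hadm)
  clear hr' hnb hsome
  have hwf := hadm.1
  have hch := hwf.chained
  have hminIdx : ∀ R ∈ Rs, R.tio.req.minIdx ≤ R.tio.idx := by
    intro R hR
    by_contra! hm
    obtain ⟨r, hr, hb⟩ := hno R.signers (S.f_lt_quorum.trans (hsig R hR))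
    exact hb (.minIndex r R hR hr hm)
  have hSig : ∀ A b B, p.ledger = A ++ b :: B → SignaturesOK K A b := by
    intro A b B hL
    by_contra hb
    -- Admissibility provides a later committed checkpoint transaction; the first one is taken, as
    -- the ground for blame requires.
    have hex : ∃ s, S.C ∣ s ∧ len (A ++ [b]) < s ∧ ∃ c, CommittedBy K p.ledger s c := by
      obtain ⟨s, c, h1, h2, h3⟩ := hadm.2.2.2.2.2 A b B hL hb
      exact ⟨s, h1, h2, c, h3⟩
    obtain ⟨h1, h2, c, hc⟩ := Nat.find_spec hex
    have hq : S.quorum ≤ c.signers.card := by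
      obtain ⟨b₁, -, b₂, -, -, -, -, hv⟩ := hc
      exact hv.1.1
    obtain ⟨r, hr, hnb⟩ := hno _ (S.f_lt_quorum.trans hq)
    exact hnb (.badSignature r r' p A B b _ c hr'R hp hadm hL hb h1 h2 hc
      (fun s' c' h3 h4 h5 h6 => Nat.find_min hex h5 ⟨h3, h4, c', h6⟩) hr)
  have hin : ∀ R ∈ Rs, ∃ b ∈ batches p.ledger, R.tio ∈ b.body.tios := by
    intro R hR
    have hmem : ∀ M : Ledger S, Chained K M → R.pp K ∈ pps M →
        ∃ b ∈ batches M, R.tio ∈ b.body.tios := by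
      intro M hM hpp
      obtain ⟨b, hb, hbR⟩ := mem_pps.1 hpp
      obtain ⟨A, B, hL⟩ := mem_batches.1 hb
      exact ⟨b, hb, (hM A b B hL).tio_mem hbR⟩
    by_cases hpp : R.pp K ∈ pps p.ledger
    · exact hmem _ hch hpp
    have hle : R.view ≤ R₀.view := by
      rcases hR₀.2 R hR with h1 | h1
      · exact h1.le
      · exact h1.1.le
    rcases (hle.trans hadm.2.1).lt_or_eq with hv | hv
    -- At the first new view beyond that of the receipt, a common member of the receipt's quorum and
    -- the view-change quorum must have reported the batch.
    · obtain ⟨A, n, B, hL, hn, hA⟩ := exists_first_newView hv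
      obtain ⟨old, hl⟩ := hwf.lineage hL
      have hsel := hl.2.2.1
      obtain ⟨r, hr, hnb⟩ := hno _ (Sys.quorum_inter (hsig R hR)
        (B := (n.vcs.map ViewChange.sender).toFinset)
        (by rw [List.toFinset_card_of_nodup hsel.2.1, List.length_map]; exact hsel.2.2.1))
      obtain ⟨hrR, hrn⟩ := Finset.mem_inter.1 hr
      obtain ⟨vc, hvc, hsender⟩ := List.mem_map.1 (List.mem_toFinset.1 hrn)
      have hrep : Reports (A ++ old.map .batch) vc (R.pp K) := by
        by_contra hrep
        have hver := ((hSig A (.newView n) B hL).1 vc hvc).1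
        exact hnb (.viewChange r r' p R A n old vc hr'R hp hadm hR hrR hl hn hvc hsender
          (hsender ▸ hver) hrep)
      obtain ⟨b, hb, hx⟩ := hmem _ hl.2.1.chained (hl.mem_pps_of_reports hvc hA hrep)
      rw [batches_append, batches_map_batch, List.mem_append] at hb
      rcases hb with hb | hb
      · exact ⟨b, mem_batches_of_prefix ⟨_, hL.symm⟩ hb, hx⟩
      · obtain ⟨c, hc, -, -, hbody⟩ := hl.2.2.2 b hb
        exact ⟨c, hc, hbody ▸ hx⟩
    · have hv₀ : R₀.view = curView p.ledger := le_antisymm hadm.2.1 (hv ▸ hle)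
      have hvR : R.view = R₀.view := hv.trans hv₀.symm
      have hseq : R.seq ≤ R₀.seq := by
        rcases hR₀.2 R hR with h1 | h1
        · omega
        · exact h1.2
      obtain ⟨r, hr, hnb⟩ := hno _ (Sys.quorum_inter (hsig R hR) (hsig R₀ hR₀.1))
      obtain ⟨hrR, hrR₀⟩ := Finset.mem_inter.1 hr
      exact absurd (.sameView r r' p R R₀ hr'R hp hadm hR hR₀.1 hvR hseq (hadm.2.2.1 hv₀.symm)
        hpp hrR hrR₀) hnb
  have hcor : ∀ n, 1 ≤ n → n ≤ len p.ledger → CorrectAt K 0 S.init (bodies p.ledger) n := by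
    intro n
    induction n using Nat.strong_induction_on with
    | _ n ih =>
      intro h1 hn
      by_contra hfail
      have hbefore : ∀ m, 1 ≤ m → m < n → CorrectAt K 0 S.init (bodies p.ledger) m :=
        fun m hm1 hm2 => ih m hm2 hm1 (by omega)
      -- Evidence for the last `P` batches comes from the message box, for earlier ones from the
      -- ledger itself.
      by_cases hP : len p.ledger < n + S.P
      · obtain ⟨e, he, hcon⟩ := hadm.2.2.2.2.1 n h1 hn hP
        have hev := hadm.2.2.2.1 e he
        obtain ⟨r, hr, hnb⟩ := hno _ (S.f_lt_quorum.trans hev.1)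
        exact hnb (.replay r r' p n e.1 e.2 hr'R hp hadm h1 hn hfail hbefore hcon hev
          (.inl he) hr)
      · obtain ⟨c, hc⟩ := hch.committedBy h1 (not_lt.1 hP) fun A b B hL _ => hSig A b B hL
        obtain ⟨b, hb, b', hb', hs, hs', hev, hv⟩ := id hc
        obtain ⟨r, hr, hnb⟩ := hno _ (S.f_lt_quorum.trans hv.1.1)
        exact hnb (.replay r r' p n b.spp (c.toPrep K) hr'R hp hadm h1 hn hfail hbefore
          ⟨hs, .inl (mem_signedPPs.2 ⟨b, hb, rfl⟩)⟩ hv.1 (.inr ⟨c, hc, rfl⟩) hr)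
  refine hviol ⟨(tios p.ledger).map Tio.req, ⟨?_, fun R hR => ?_⟩, fun a ha b hb hab => ?_⟩
  · intro t ht
    obtain ⟨x, hx, rfl⟩ := List.mem_map.1 ht
    obtain ⟨bd, hbd, hx⟩ := List.mem_flatMap.1 hx
    obtain ⟨b, hb, rfl⟩ := List.mem_map.1 hbd
    obtain ⟨A, B, hL⟩ := mem_batches.1 hb
    exact (hSig A (.batch b) B hL).2.1 x hx
  · obtain ⟨b, hb, hx⟩ := hin R hR
    have hbs := hch.seq_bounds hb
    exact hch.produces hb (hcor b.seq hbs.1 hbs.2) hx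
  · obtain ⟨hcl, h, h', hhist, hnew, R, hRh, hRv, hRa⟩ := hab
    -- The client put the minimum index above that of `a`, and no receipt lies below its minimum
    -- index.
    have h1 := E.minIdx_rule _ hcl h _ h' hhist hnew R hRh hRv
    have h2 := hminIdx b hb
    rw [hRa] at h1
    omega

end
end LPBFT

/-! ### The two halves combined -/

open LPBFT
theorem mainTheorem2 (S : Sys) (K : Crypto S) (E : Execution K)
    (Rs : Finset (Receipt S)) (hvalid : ∀ R ∈ Rs, R.Valid K) (hcoll : E.Collected Rs)
    (hviol : ¬ E.Linearizable Rs)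
    (R₀ : Receipt S) (hR₀ : IsLatest Rs R₀)
    (resp : Fin S.N → Option (Package S))
    (hresp : ∀ r ∈ E.correct, ∀ p, resp r = some p → p = (E.atAudit r).package) :
    S.f + 1 ≤ (blame K Rs R₀ resp).card ∧
    ∀ r ∈ blame K Rs R₀ resp, r ∉ E.correct ∨ (r ∈ R₀.signers ∧ resp r = none) := by
  unfold blame
  split_ifs with hcard
  · refine ⟨le_card_blamed E hvalid hviol hR₀ hcard, fun r hr => .inl fun hrc => ?_⟩
    exact not_blamed E hvalid hcoll hR₀.1 hresp hrc (by simpa using hr)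
  · constructor
    · have h1 : S.quorum ≤ R₀.signers.card := (hvalid R₀ hR₀.1).1.1
      -- At least `N - f` replicas were contacted and at most `f` responded, which leaves `N - 2 f ≥
      -- f + 1`.
      have h2 := Finset.le_card_sdiff (responders R₀ resp) R₀.signers
      have h3 := S.N_pos
      unfold Sys.quorum at h1
      unfold Sys.f at *
      omega
    · intro r hr
      obtain ⟨h1, h2⟩ := Finset.mem_sdiff.1 hr
      refine .inr ⟨h1, ?_⟩
      simpa [responders, h1] using h2
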